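/- Let $$\Xi_G=\Bigl\{x=\sum_{k=1}^\infty x_k2^{-k}:\ x_k\in\{0,1\},\ x_kx_{2k}=0\text{ for all }k\ge1\Bigr\}\subset[0,1].$$ For a function $\varphi\ge 0$ defined on some interval $[0,\varepsilon)$, let $\mathcal H^{\varphi}$ denote the generalized Hausdorff measure on $\mathbb R$ with gauge $\varphi$, that is, $\mathcal H^{\varphi}(A)=\lim_{r\to0}\inf\bigl\{\sum_i\varphi(\operatorname{diam}U_i):A\subset\bigcup_iU_i,\ \operatorname{diam}U_i\le r\bigr\}$ (countable covers), and let $\mathcal H^s$ be the $s$-dimensional Hausdorff measure. Let $0<p<1$ be the solution of $p^3=(1-p)^2$ and let $s=\dim_H\Xi_G$ be the Hausdorff dimension. Then $s=-\log_2p$, and the following hold. (i) $\mathcal H^s(\Xi_G)=\infty$, and $\Xi_G$ is not $\sigma$-finite with respect to $\mathcal H^s$. Moreover, there is $c_0>0$ such that for every $0<c<c_0$ and the gauge $$\phi(t)=t^s\exp\Bigl[-c\,\frac{|\log t|}{(\log|\log t|)^2}\Bigr]\quad(t>0\text{ small}),\qquad \phi(0)=0,$$ we have $\mathcal H^{\phi}(\Xi_G)=\infty$,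 and $\Xi_G$ is not $\sigma$-finite with respect to $\mathcal H^{\phi}$. (ii) For every real $\theta<2$ and the gauge $$\psi_\theta(t)=t^s\exp\Bigl[-\frac{|\log t|}{(\log|\log t|)^\theta}\Bigr]\quad(t>0\text{ small}),\qquad \psi_\theta(0)=0,$$ we have $\mathcal H^{\psi_\theta}(\Xi_G)=0$. -/

import Mathlib

open MeasureTheory

/-- The multiplicative golden mean shift: the reals `x = ∑_{k ≥ 1} a_k 2^{-k}` with digits
`a_k ∈ {0, 1}` such that `a_k a_{2k} = 0` for all `k ≥ 1`. (The value `a 0` plays no role.) -/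
def XiG : Set ℝ :=
  {x | ∃ a : ℕ → ℕ, (∀ k, a k = 0 ∨ a k = 1) ∧ (∀ k, 1 ≤ k → a k * a (2 * k) = 0) ∧
    HasSum (fun k : ℕ => (a (k + 1) : ℝ) / 2 ^ (k + 1)) x}

/-- The generalized Hausdorff measure `ℋ^φ` on `ℝ` with gauge `φ`: the limit, as `r → 0`, of the
infima of `∑ φ (diam Uᵢ)` over countable covers by sets `Uᵢ` of diameter at most `r`. It depends
only on the values of `φ` on an arbitrarily small interval `[0, ε)`. -/
noncomputable def gaugeMeasure (φ : ℝ → ℝ) : Measure ℝ :=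
  Measure.mkMetric fun d : ENNReal => ENNReal.ofReal (φ d.toReal)

/-- `φ(t) = t^s exp[-c |log t| / (log |log t|)^2]`. -/
noncomputable def phiGauge (s c t : ℝ) : ℝ :=
  t ^ s * Real.exp (-c * (|Real.log t| / (Real.log |Real.log t|) ^ 2))

/-- `ψ_θ(t) = t^s exp[-|log t| / (log |log t|)^θ]`. -/
noncomputable def psiGauge (s θ t : ℝ) : ℝ :=
  t ^ s * Real.exp (-(|Real.log t| / (Real.log |Real.log t|) ^ θ))

/-! Golden sequences are produced by independent bits: the bit at `2k` is erased when the digit at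
`k` is one. If the bit at `k` is one with probability `h k`, a prefix has probability `exp
(-surprisal)`, and the surprisal is affine in the digits. Write `q = 1 - p` and `L = -log p`, so
that `-log q = 3L/2`. For the constant bias `q` the surprisal of the first `n` digits is exactly `n
L + (L/2) (N(n) - 2 N(n/2))`, where `N` counts ones. Everything beyond the dimension thus depends on
how the density of ones changes from `n/2` to `n`.

Lower bound. Let the density of ones climb to its stationary value like `R - η / log n`. Each
doubling raises it by about `η / (log n)^2`, while the biases needed are off by `O(η / log n)` and
cost only `O(η^2 / (log n)^2)` of entropy per digit. For small `η` the mean surprisal exceeds `n L`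
by a multiple of `n / (log n)^2` (`exists_bias`). Chebyshev and Borel–Cantelli along squares make
this almost sure (`exists_bias_ae`), and a mass distribution argument (`gaugeMeasure_ne_zero`) gives
positive measure for every small `c`. Lowering `c` enlarges the gauge by an unbounded factor, so
σ-finiteness for a smaller `c` would force a null set for a larger one
(`not_sigmaFinite_of_ne_zero`). The case `c = 0` is the Hausdorff measure.

Upper bound. No sequence can keep such a gain with an arbitrarily large constant. Test a golden
sequence at length `2^m` against the two biases `q ± K/m`. If both failed to predict it at rate `L +
C/m^2` for all large `m`, the deviation `β` of its density from `R` would satisfy `β m - β (m+1) ≥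
1/(m+1)^2 + 2|β (m+1)|/(m+1)`, which is impossible for a bounded sequence (`no_riccati_decrease`).
So every point has infinitely many well predicted prefixes (`exists_frequently_surprisal_le`). These
are few (`card_le_exp_of_surprisal_le`), and for `θ < 2` they give covers of summable gauge
(`gaugeMeasure_eq_zero_of_covers`). -/

open ProbabilityTheory Filter Topology
open scoped ENNReal

/-! ### Coding by free bits, and the probability of a prefix -/

/-- The digit sequence obtained from free bits `b` by erasing a bit at `2 * k` whenever the digit
at `k` is one. -/
def goldenDigit (b : ℕ → Bool) : ℕ → Bool
  | 0 => false
  | k + 1 => b (k + 1) && !(decide (Even (k + 1)) && goldenDigit b ((k + 1) / 2))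
decreasing_by omega

/-- A binary sequence with no ones at positions `k` and `2 * k` simultaneously. -/
def IsGolden (a : ℕ → Bool) : Prop := ∀ k, 1 ≤ k → a k = true → a (2 * k) = false

/-- The position `k` is forced to carry a zero by a one at `k / 2`. -/
def Blocked (a : ℕ → Bool) (k : ℕ) : Prop := Even k ∧ a (k / 2) = true

instance (a : ℕ → Bool) (k : ℕ) : Decidable (Blocked a k) := by
  unfold Blocked; infer_instance

/-- The digit `a k` as a real number. -/
def digitVal (a : ℕ → Bool) (k : ℕ) : ℝ := if a k = true then 1 else 0

lemma goldenDigit_of_blocked {b : ℕ → Bool} {k : ℕ} (hk : 1 ≤ k)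
    (h : Blocked (goldenDigit b) k) : goldenDigit b k = false := by
  obtain ⟨k, rfl⟩ : ∃ m, k = m + 1 := ⟨k - 1, by omega⟩
  rw [goldenDigit]
  simp [h.1, h.2]

lemma goldenDigit_of_not_blocked {b : ℕ → Bool} {k : ℕ} (hk : 1 ≤ k)
    (h : ¬ Blocked (goldenDigit b) k) : goldenDigit b k = b k := by
  obtain ⟨k, rfl⟩ : ∃ m, k = m + 1 := ⟨k - 1, by omega⟩
  rw [goldenDigit]
  unfold Blocked at h
  rw [not_and_or] at h
  rcases h with h | h
  · simp [h]
  · simp [h]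

lemma isGolden_goldenDigit (b : ℕ → Bool) : IsGolden (goldenDigit b) := by
  intro k hk h
  exact goldenDigit_of_blocked (by omega) ⟨even_two_mul k, by simpa using h⟩

lemma IsGolden.of_blocked {a : ℕ → Bool} (ha : IsGolden a) {k : ℕ} (hk : 1 ≤ k)
    (h : Blocked a k) : a k = false := by
  obtain ⟨m, rfl⟩ := h.1.two_dvd
  have h2 := h.2
  rw [Nat.mul_div_cancel_left _ two_pos] at h2
  exact ha m (by omega) h2

/-- The prefix of `goldenDigit b` is determined by the bits of `b` at unblocked positions. -/
lemma goldenDigit_prefix_iff {a : ℕ → Bool} (ha : IsGolden a) (h0 : a 0 = false) (b : ℕ → Bool)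
    (n : ℕ) : (∀ k ∈ Finset.Icc 1 n, goldenDigit b k = a k) ↔
      ∀ k ∈ (Finset.Icc 1 n).filter (fun k => ¬ Blocked a k), b k = a k := by
  -- Whether `k` is blocked depends only on the digit at `k / 2 < k`. For `k = 1` this is the digit
  -- at `0`, which is why `a 0` is normalised.
  have key : ∀ k, (∀ j < k, goldenDigit b j = a j) → 1 ≤ k →
      (Blocked (goldenDigit b) k ↔ Blocked a k) := by
    intro k hk h1
    unfold Blocked
    rw [hk (k / 2) (by omega)]
  constructor
  · intro h k hk
    rw [Finset.mem_filter, Finset.mem_Icc] at hk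
    rw [← h k (Finset.mem_Icc.2 hk.1), goldenDigit_of_not_blocked hk.1.1]
    rw [key k _ hk.1.1]
    · exact hk.2
    · intro j hj
      rcases Nat.eq_zero_or_pos j with rfl | hj0
      · rw [h0, goldenDigit]
      · exact h j (Finset.mem_Icc.2 ⟨hj0, by omega⟩)
  · intro h k
    induction k using Nat.strong_induction_on with
    | _ k ih =>
      intro hk
      rw [Finset.mem_Icc] at hk
      have hlt : ∀ j < k, goldenDigit b j = a j := by
        intro j hj
        rcases Nat.eq_zero_or_pos j with rfl | hj0
        · rw [h0, goldenDigit]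
        · exact ih j hj (Finset.mem_Icc.2 ⟨hj0, by omega⟩)
      by_cases hb : Blocked a k
      · rw [ha.of_blocked hk.1 hb]
        exact goldenDigit_of_blocked hk.1 ((key k hlt hk.1).2 hb)
      · rw [goldenDigit_of_not_blocked hk.1 (fun h' => hb ((key k hlt hk.1).1 h'))]
        exact h k (Finset.mem_filter.2 ⟨Finset.mem_Icc.2 hk, hb⟩)

/-- Minus the logarithm of the probability of the prefix of length `n` of `a`, when an unblocked
position `k` carries a one with probability `h k`. -/
noncomputable def surprisal (h : ℕ → ℝ) (a : ℕ → Bool) (n : ℕ) : ℝ :=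
  ∑ k ∈ (Finset.Icc 1 n).filter (fun k => ¬ Blocked a k),
    if a k = true then -Real.log (h k) else -Real.log (1 - h k)

/-- Independent bits, the `k`-th one being `true` with probability `h k`. -/
noncomputable def bitMeasure (h : ℕ → unitInterval) : Measure (ℕ → Bool) :=
  Measure.infinitePi fun k => bernoulliMeasure true false (h k)

instance (h : ℕ → unitInterval) : IsProbabilityMeasure (bitMeasure h) := by
  unfold bitMeasure; infer_instance

/-- Fixing a prefix constrains exactly the bits at unblocked positions, so the event is a cylinder
and its probability a product of marginals. -/
lemma bitMeasure_prefix (h : ℕ → unitInterval) (hpos : ∀ k, 0 < (h k : ℝ))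
    (hlt : ∀ k, (h k : ℝ) < 1) {a : ℕ → Bool} (ha : IsGolden a) (h0 : a 0 = false) (n : ℕ) :
    bitMeasure h {b | ∀ k ∈ Finset.Icc 1 n, goldenDigit b k = a k} =
      ENNReal.ofReal (Real.exp (-surprisal (fun k => h k) a n)) := by
  have hset : {b | ∀ k ∈ Finset.Icc 1 n, goldenDigit b k = a k} =
      Set.pi (((Finset.Icc 1 n).filter (fun k => ¬ Blocked a k) : Finset ℕ) : Set ℕ)
        (fun k => {a k}) := by
    ext b
    rw [Set.mem_ofPred_eq, goldenDigit_prefix_iff ha h0]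
    simp only [Set.mem_pi, Finset.mem_coe, Set.mem_singleton_iff]
  rw [hset, bitMeasure, Measure.infinitePi_pi _ (fun _ _ => measurableSet_singleton _), surprisal,
    ← Finset.sum_neg_distrib, Real.exp_sum, ENNReal.ofReal_prod_of_nonneg
      (fun _ _ => (Real.exp_pos _).le)]
  refine Finset.prod_congr rfl fun k _ => ?_
  rcases hk : a k with _ | _
  · simp only [Bool.false_eq_true, if_false, neg_neg]
    rw [Real.exp_log (by linarith [hlt k]), bernoulliMeasure_apply_of_notMem_of_mem _
      (measurableSet_singleton _) (by simp) (by simp)]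
    rw [ENNReal.ofReal]
    congr 1
    ext
    simp [(hlt k).le]
  · simp only [if_true, neg_neg]
    rw [Real.exp_log (hpos k), bernoulliMeasure_apply_of_mem_of_notMem _
      (measurableSet_singleton _) (by simp) (by simp)]
    rw [ENNReal.ofReal]
    congr 1
    ext
    simp [(hpos k).le]

lemma sum_Icc_even {M : Type*} [AddCommMonoid M] (f : ℕ → M) (n : ℕ) :
    ∑ k ∈ Finset.Icc 1 n, (if Even k then f (k / 2) else 0) = ∑ m ∈ Finset.Icc 1 (n / 2), f m := by
  induction n with
  | zero => simp
  | succ n ih =>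
    rw [Finset.sum_Icc_succ_top (by omega), ih]
    rcases Nat.even_or_odd (n + 1) with h | h
    · obtain ⟨m, hm⟩ := h.two_dvd
      have h1 : (n + 1) / 2 = n / 2 + 1 := by omega
      rw [if_pos h, h1, Finset.sum_Icc_succ_top (by omega)]
    · rw [if_neg (by simpa using h)]
      obtain ⟨m, hm⟩ := h
      have h1 : (n + 1) / 2 = n / 2 := by omega
      rw [h1, add_zero]

/-- The surprisal is an affine function of the digits. -/
lemma surprisal_eq (h : ℕ → ℝ) {a : ℕ → Bool} (ha : IsGolden a) (n : ℕ) :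
    surprisal h a n = ∑ k ∈ Finset.Icc 1 n, (-Real.log (1 - h k))
      + ∑ k ∈ Finset.Icc 1 n, (Real.log (1 - h k) - Real.log (h k)) * digitVal a k
      + ∑ m ∈ Finset.Icc 1 (n / 2), Real.log (1 - h (2 * m)) * digitVal a m := by
  rw [← sum_Icc_even, ← Finset.sum_add_distrib, ← Finset.sum_add_distrib, surprisal,
    Finset.sum_filter]
  refine Finset.sum_congr rfl fun k hk => ?_
  rw [Finset.mem_Icc] at hk
  unfold digitVal
  -- A blocked `k = 2m` contributes nothing to the surprisal: its digit is zero and the third sum,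
  -- through the one at `m`, cancels `-log (1 - h k)`.
  by_cases hb : Blocked a k
  · have h1 := ha.of_blocked hk.1 hb
    rw [if_neg (not_not.2 hb), if_pos hb.1, h1, hb.2, Nat.mul_div_cancel' hb.1.two_dvd]
    simp
  · rw [if_pos hb]
    have : (if Even k then Real.log (1 - h (2 * (k / 2))) * (if a (k / 2) = true then (1 : ℝ) else 0)
        else 0) = 0 := by
      unfold Blocked at hb
      rw [not_and_or] at hb
      rcases hb with hb | hb <;> simp [hb]
    rw [this]
    split_ifs <;> ring

/-! ### Means, independence and variance of the digits -/

/-- The positions whose bits may influence the digit at `k`. -/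
def chainTo (k : ℕ) : Finset ℕ :=
  (Finset.Icc 1 k).filter (fun j => ordCompl[2] j = ordCompl[2] k)

lemma ordCompl_two_mul (m : ℕ) : ordCompl[2] (2 * m) = ordCompl[2] m := by
  rw [Nat.ordCompl_mul]
  simp [Nat.prime_two.factorization_self]

lemma goldenDigit_congr {b b' : ℕ → Bool} (k : ℕ) (h : ∀ j ∈ chainTo k, b j = b' j) :
    goldenDigit b k = goldenDigit b' k := by
  induction k using Nat.strong_induction_on with
  | _ k ih =>
    rcases k with _ | k
    · simp [goldenDigit]
    rw [goldenDigit, goldenDigit, h (k + 1) (by simp [chainTo])]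
    by_cases hk : Even (k + 1)
    · obtain ⟨m, hm⟩ := hk.two_dvd
      have h1 : (k + 1) / 2 = m := by omega
      rw [h1, ih m (by omega)]
      intro j hj
      apply h
      simp only [chainTo, Finset.mem_filter, Finset.mem_Icc] at hj ⊢
      rw [hm, ordCompl_two_mul]
      exact ⟨⟨hj.1.1, by omega⟩, hj.2⟩
    · simp [hk]

/-- Reconstruction of the digit at `k` from the bits in `chainTo k`. -/
def digitOfChain (k : ℕ) (v : chainTo k → Bool) : ℝ :=
  digitVal (goldenDigit fun j => if h : j ∈ chainTo k then v ⟨j, h⟩ else false) k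

lemma digitVal_goldenDigit_eq (k : ℕ) (b : ℕ → Bool) :
    digitVal (goldenDigit b) k = digitOfChain k (fun i => b i) := by
  unfold digitOfChain digitVal
  rw [goldenDigit_congr (b := b) k]
  intro j hj
  simp [hj]

lemma measurable_digitVal (k : ℕ) : Measurable fun b => digitVal (goldenDigit b) k := by
  simp_rw [digitVal_goldenDigit_eq]
  exact (measurable_of_countable (digitOfChain k)).comp (by fun_prop)

lemma digitVal_nonneg (a : ℕ → Bool) (k : ℕ) : 0 ≤ digitVal a k := by
  unfold digitVal; split_ifs <;> norm_num

lemma digitVal_le_one (a : ℕ → Bool) (k : ℕ) : digitVal a k ≤ 1 := by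
  unfold digitVal; split_ifs <;> norm_num

lemma memLp_digitVal (h : ℕ → unitInterval) (k : ℕ) (q : ℝ≥0∞) :
    MemLp (fun b => digitVal (goldenDigit b) k) q (bitMeasure h) := by
  refine MemLp.of_bound (measurable_digitVal k).aestronglyMeasurable 1 (ae_of_all _ fun b => ?_)
  rw [Real.norm_of_nonneg (digitVal_nonneg _ _)]
  exact digitVal_le_one _ _

lemma iIndepFun_bits (h : ℕ → unitInterval) :
    iIndepFun (fun k (b : ℕ → Bool) => b k) (bitMeasure h) :=
  iIndepFun_infinitePi (X := fun _ x => x) (by fun_prop)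

/-- Doubling preserves the odd part, so digits whose positions have different odd parts are
functions of disjoint sets of independent bits. -/
lemma indepFun_digitVal (h : ℕ → unitInterval) {j k : ℕ} (hjk : ordCompl[2] j ≠ ordCompl[2] k) :
    IndepFun (fun b => digitVal (goldenDigit b) j) (fun b => digitVal (goldenDigit b) k)
      (bitMeasure h) := by
  have hd : Disjoint (chainTo j) (chainTo k) := by
    rw [Finset.disjoint_left]
    intro i hi hi'
    simp only [chainTo, Finset.mem_filter] at hi hi'
    exact hjk (hi.2.symm.trans hi'.2)
  have := (iIndepFun_bits h).indepFun_finset _ _ hd (by fun_prop)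
  have h2 := this.comp (measurable_of_countable (digitOfChain j))
    (measurable_of_countable (digitOfChain k))
  simp_rw [digitVal_goldenDigit_eq]
  exact h2

/-- The expected value of the digit at `k`. -/
noncomputable def meanDigit (h : ℕ → ℝ) : ℕ → ℝ
  | 0 => 0
  | k + 1 => h (k + 1) * (1 - if Even (k + 1) then meanDigit h ((k + 1) / 2) else 0)
decreasing_by omega

lemma integral_bit (h : ℕ → unitInterval) (k : ℕ) :
    ∫ b, digitVal b k ∂(bitMeasure h) = h k := by
  have h1 : ∫ x, (if x = true then (1 : ℝ) else 0) ∂((bitMeasure h).map (fun b => b k)) =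
      ∫ b, digitVal b k ∂(bitMeasure h) :=
    integral_map (measurable_pi_apply k).aemeasurable
      (measurable_of_countable _).aestronglyMeasurable
  rw [← h1, bitMeasure, Measure.infinitePi_map_eval, integral_fintype (.of_finite)]
  simp

lemma integral_digitVal (h : ℕ → unitInterval) (k : ℕ) :
    ∫ b, digitVal (goldenDigit b) k ∂(bitMeasure h) = meanDigit (fun k => h k) k := by
  induction k using Nat.strong_induction_on with
  | _ k ih =>
    rcases k with _ | k
    · simp [goldenDigit, meanDigit, digitVal]
    rw [meanDigit]
    by_cases hk : Even (k + 1)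
    · obtain ⟨m, hm⟩ := hk.two_dvd
      have h1 : (k + 1) / 2 = m := by omega
      have hd : Disjoint {k + 1} (chainTo m) := by
        rw [Finset.disjoint_left]
        intro i hi hi'
        simp only [chainTo, Finset.mem_filter, Finset.mem_Icc, Finset.mem_singleton] at hi hi'
        omega
      have hind := (iIndepFun_bits h).indepFun_finset _ _ hd (by fun_prop)
      have h2 := hind.comp
        (φ := fun v : ({k + 1} : Finset ℕ) → Bool =>
          if v ⟨k + 1, by simp⟩ = true then (1 : ℝ) else 0)
        (measurable_of_countable _) (ψ := fun v => 1 - digitOfChain m v)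
        (measurable_of_countable _)
      rw [if_pos hk, h1, ← ih m (by omega), ← integral_bit h (k + 1)]
      have h3 := h2.integral_mul_eq_mul_integral
        (by exact ((measurable_of_countable _).comp (by fun_prop)).aestronglyMeasurable)
        (by exact ((measurable_of_countable _).comp (by fun_prop)).aestronglyMeasurable)
      -- For `k + 1 = 2m` the digit is the fresh bit times one minus the digit at `m`; the latter
      -- only sees bits up to `m`, hence the factors are independent.
      have h4 : ∀ b, digitVal (goldenDigit b) (k + 1) =
          digitVal b (k + 1) * (1 - digitVal (goldenDigit b) m) := by
        intro b
        unfold digitVal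
        rw [goldenDigit, h1]
        simp only [hk, decide_true, Bool.true_and]
        rcases b (k + 1) <;> rcases goldenDigit b m <;> simp
      simp_rw [h4]
      have h5 : 1 - ∫ b, digitVal (goldenDigit b) m ∂(bitMeasure h) =
          ∫ b, (1 - digitVal (goldenDigit b) m) ∂(bitMeasure h) := by
        rw [integral_sub (integrable_const _) ((memLp_digitVal h m 1).integrable le_rfl)]
        simp
      rw [h5]
      simp_rw [digitVal_goldenDigit_eq]
      exact h3
    · rw [if_neg hk, ← integral_bit h (k + 1), sub_zero, mul_one]
      refine integral_congr_ae (ae_of_all _ fun b => ?_)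
      simp [digitVal, goldenDigit, hk]

lemma abs_covariance_digitVal_le (h : ℕ → unitInterval) (j k : ℕ) :
    |cov[fun b => digitVal (goldenDigit b) j, fun b => digitVal (goldenDigit b) k;
      bitMeasure h]| ≤ 1 := by
  rw [covariance_eq_sub (memLp_digitVal h j 2) (memLp_digitVal h k 2)]
  have hb : ∀ f : (ℕ → Bool) → ℝ, (∀ b, 0 ≤ f b) → (∀ b, f b ≤ 1) →
      0 ≤ ∫ b, f b ∂(bitMeasure h) ∧ ∫ b, f b ∂(bitMeasure h) ≤ 1 := by
    intro f h0 h1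
    refine ⟨integral_nonneg h0, ?_⟩
    have := integral_mono_of_nonneg (μ := bitMeasure h) (ae_of_all _ h0)
      (integrable_const (1 : ℝ)) (ae_of_all _ h1)
    simpa using this
  have h1 := hb _ (fun b => digitVal_nonneg (goldenDigit b) j) (fun b => digitVal_le_one _ _)
  have h2 := hb _ (fun b => digitVal_nonneg (goldenDigit b) k) (fun b => digitVal_le_one _ _)
  have h3 := hb (fun b => digitVal (goldenDigit b) j * digitVal (goldenDigit b) k)
    (fun b => mul_nonneg (digitVal_nonneg _ _) (digitVal_nonneg _ _))
    (fun b => mul_le_one₀ (digitVal_le_one _ _) (digitVal_nonneg _ _) (digitVal_le_one _ _))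
  have h4 := mul_nonneg h1.1 h2.1
  have h5 := mul_le_one₀ h1.2 h2.1 h2.2
  rw [abs_le]
  constructor
  · have := h3.1
    simp only [Pi.mul_apply]
    linarith
  · have := h3.2
    simp only [Pi.mul_apply]
    linarith

lemma card_same_ordCompl_le (n j : ℕ) :
    ((Finset.Icc 1 n).filter (fun k => ordCompl[2] j = ordCompl[2] k)).card ≤ Nat.log 2 n + 1 := by
  have : (Finset.Icc 1 n).filter (fun k => ordCompl[2] j = ordCompl[2] k) ⊆
      (Finset.range (Nat.log 2 n + 1)).image (fun v => 2 ^ v * ordCompl[2] j) := by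
    intro k hk
    rw [Finset.mem_filter, Finset.mem_Icc] at hk
    rw [Finset.mem_image]
    refine ⟨k.factorization 2, ?_, ?_⟩
    · rw [Finset.mem_range, Nat.lt_succ_iff]
      exact Nat.le_log_of_pow_le one_lt_two
        ((Nat.ordProj_le 2 (by omega)).trans hk.1.2)
    · rw [hk.2]
      exact Nat.ordProj_mul_ordCompl_eq_self k 2
  exact (Finset.card_le_card this).trans (Finset.card_image_le.trans (by simp))

/-- Only digits on the same chain `2^v * odd` are correlated, so each row of the covariance matrix
has at most `log₂ n + 1` nonzero entries. -/
lemma variance_sum_digitVal_le (h : ℕ → unitInterval) (n : ℕ) (w : ℕ → ℝ) {W : ℝ}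
    (hw : ∀ k, |w k| ≤ W) :
    Var[fun b => ∑ k ∈ Finset.Icc 1 n, w k * digitVal (goldenDigit b) k; bitMeasure h] ≤
      W ^ 2 * (n * (Nat.log 2 n + 1)) := by
  have hW : 0 ≤ W := (abs_nonneg _).trans (hw 0)
  rw [variance_fun_sum' (fun k _ => (memLp_digitVal h k 2).const_mul _)]
  have hrow : ∀ j ∈ Finset.Icc 1 n, ∑ k ∈ Finset.Icc 1 n,
      cov[fun b => w j * digitVal (goldenDigit b) j, fun b => w k * digitVal (goldenDigit b) k;
        bitMeasure h] ≤ W ^ 2 * (Nat.log 2 n + 1) := by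
    intro j _
    have hterm : ∀ k ∈ Finset.Icc 1 n,
        cov[fun b => w j * digitVal (goldenDigit b) j, fun b => w k * digitVal (goldenDigit b) k;
          bitMeasure h] ≤ if ordCompl[2] j = ordCompl[2] k then W ^ 2 else 0 := by
      intro k _
      rw [covariance_const_mul_left, covariance_const_mul_right]
      split_ifs with hjk
      · refine (le_abs_self _).trans ?_
        rw [abs_mul, abs_mul, ← mul_assoc, sq]
        refine (mul_le_mul (mul_le_mul (hw j) (hw k) (abs_nonneg _) hW)
          (abs_covariance_digitVal_le h j k) (abs_nonneg _) (by positivity)).trans ?_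
        rw [mul_one]
      · rw [(indepFun_digitVal h hjk).covariance_eq_zero (memLp_digitVal h j 2)
          (memLp_digitVal h k 2)]
        simp
    refine (Finset.sum_le_sum hterm).trans ?_
    rw [← Finset.sum_filter, Finset.sum_const, nsmul_eq_mul, mul_comm]
    gcongr
    exact_mod_cast card_same_ordCompl_le n j
  refine (Finset.sum_le_sum hrow).trans (le_of_eq ?_)
  rw [Finset.sum_const, nsmul_eq_mul, Nat.card_Icc, Nat.add_sub_cancel]
  ring

/-! ### Expected surprisal as entropy -/

/-- The expected surprisal of the first `n` digits. -/
noncomputable def meanSurprisal (h : ℕ → ℝ) (n : ℕ) : ℝ :=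
  ∑ k ∈ Finset.Icc 1 n, (-Real.log (1 - h k))
    + ∑ k ∈ Finset.Icc 1 n, (Real.log (1 - h k) - Real.log (h k)) * meanDigit h k
    + ∑ m ∈ Finset.Icc 1 (n / 2), Real.log (1 - h (2 * m)) * meanDigit h m

lemma meanDigit_eq (h : ℕ → ℝ) {k : ℕ} (hk : 1 ≤ k) :
    meanDigit h k = h k * (1 - if Even k then meanDigit h (k / 2) else 0) := by
  obtain ⟨k, rfl⟩ : ∃ m, k = m + 1 := ⟨k - 1, by omega⟩
  rw [meanDigit]

lemma meanDigit_mem {h : ℕ → ℝ} (h0 : ∀ k, 0 ≤ h k) (h1 : ∀ k, h k ≤ 1) (k : ℕ) :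
    0 ≤ meanDigit h k ∧ meanDigit h k ≤ 1 := by
  induction k using Nat.strong_induction_on with
  | _ k ih =>
    rcases k with _ | k
    · simp [meanDigit]
    rw [meanDigit]
    have := ih ((k + 1) / 2) (by omega)
    have hk0 := h0 (k + 1)
    have hk1 := h1 (k + 1)
    split_ifs
    · constructor
      · exact mul_nonneg hk0 (by linarith)
      · exact mul_le_one₀ hk1 (by linarith) (by linarith)
    · constructor <;> linarith

/-- Quadratic lower bound for the entropy around `q`. -/
lemma entropy_ge {t q : ℝ} (ht0 : 0 < t) (ht1 : t < 1) (hq0 : 0 < q) (hq1 : q < 1) :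
    -t * Real.log q - (1 - t) * Real.log (1 - q) - (t - q) ^ 2 / (q * (1 - q)) ≤
      -t * Real.log t - (1 - t) * Real.log (1 - t) := by
  have h1 : Real.log t - Real.log q ≤ t / q - 1 := by
    rw [← Real.log_div ht0.ne' hq0.ne']
    exact Real.log_le_sub_one_of_pos (div_pos ht0 hq0)
  have h2 : Real.log (1 - t) - Real.log (1 - q) ≤ (1 - t) / (1 - q) - 1 := by
    rw [← Real.log_div (by linarith) (by linarith)]
    exact Real.log_le_sub_one_of_pos (div_pos (by linarith) (by linarith))
  have h3 := mul_le_mul_of_nonneg_left h1 ht0.le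
  have h4 := mul_le_mul_of_nonneg_left h2 (sub_pos.2 ht1).le
  have h5 : t * (t / q - 1) + (1 - t) * ((1 - t) / (1 - q) - 1) = (t - q) ^ 2 / (q * (1 - q)) := by
    have : 1 - q ≠ 0 := by linarith
    field_simp
    ring
  linarith

/-- Chain rule for entropy: position `k` is unblocked with probability one minus the mean digit at
`k / 2` (for even `k`), and then costs the entropy of a bit of bias `h k`. -/
lemma meanSurprisal_eq (h : ℕ → ℝ) (n : ℕ) :
    meanSurprisal h n = ∑ k ∈ Finset.Icc 1 n,
      (1 - if Even k then meanDigit h (k / 2) else 0) *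
        (-h k * Real.log (h k) - (1 - h k) * Real.log (1 - h k)) := by
  rw [meanSurprisal, ← sum_Icc_even, ← Finset.sum_add_distrib, ← Finset.sum_add_distrib]
  refine Finset.sum_congr rfl fun k hk => ?_
  rw [Finset.mem_Icc] at hk
  rw [meanDigit_eq h hk.1]
  split_ifs with he
  · rw [Nat.mul_div_cancel' he.two_dvd]
    ring
  · ring

/-- With `L = -log p`, the tangent to the entropy at `1 - p` is `L + (L/2) t`, thanks to `hlog`.
Weighting it by the probability of being unblocked and summing gives the telescoping main terms; the
quadratic term is the loss from `entropy_ge`. -/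
lemma meanSurprisal_ge {p : ℝ} (hp0 : 0 < p) (hp1 : p < 1)
    (hlog : Real.log (1 - p) = 3 / 2 * Real.log p) {h : ℕ → ℝ} (h0 : ∀ k, 0 < h k)
    (h1 : ∀ k, h k < 1) (n : ℕ) :
    n * (-Real.log p) + (-Real.log p) / 2 * (∑ k ∈ Finset.Icc 1 n, meanDigit h k -
      2 * ∑ k ∈ Finset.Icc 1 (n / 2), meanDigit h k)
      - (∑ k ∈ Finset.Icc 1 n, (h k - (1 - p)) ^ 2) / ((1 - p) * p) ≤ meanSurprisal h n := by
  have hterm : ∀ k ∈ Finset.Icc 1 n, (-Real.log p) + (-Real.log p) / 2 * meanDigit h k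
      - (-Real.log p) * (if Even k then meanDigit h (k / 2) else 0)
      - (h k - (1 - p)) ^ 2 / ((1 - p) * p) ≤
      (1 - if Even k then meanDigit h (k / 2) else 0) *
        (-h k * Real.log (h k) - (1 - h k) * Real.log (1 - h k)) := by
    intro k hk
    rw [Finset.mem_Icc] at hk
    have he := entropy_ge (h0 k) (h1 k) (q := 1 - p) (by linarith) (by linarith)
    rw [sub_sub_cancel, hlog] at he
    have hmem := meanDigit_mem (fun k => (h0 k).le) (fun k => (h1 k).le) (k / 2)
    rw [meanDigit_eq h hk.1]
    set e := if Even k then meanDigit h (k / 2) else 0 with hedef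
    have he0 : 0 ≤ e := by rw [hedef]; split_ifs <;> linarith
    have he1 : e ≤ 1 := by rw [hedef]; split_ifs <;> linarith
    have h3 := mul_le_mul_of_nonneg_left he (sub_nonneg.2 he1)
    refine le_trans ?_ h3
    have h4 : 0 ≤ e * ((h k - (1 - p)) ^ 2 / ((1 - p) * p)) :=
      mul_nonneg he0 (div_nonneg (sq_nonneg _) (mul_nonneg (by linarith) hp0.le))
    nlinarith
  rw [meanSurprisal_eq]
  refine le_trans (le_of_eq ?_) (Finset.sum_le_sum hterm)
  rw [Finset.sum_sub_distrib, Finset.sum_sub_distrib, Finset.sum_add_distrib, Finset.sum_const,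
    ← Finset.mul_sum, ← Finset.mul_sum, sum_Icc_even, ← Finset.sum_div]
  simp only [Nat.card_Icc, Nat.add_sub_cancel, nsmul_eq_mul]
  ring

/-! ### Biases constant on dyadic blocks -/

lemma log_two_mul' {m : ℕ} (hm : 1 ≤ m) : Nat.log 2 (2 * m) = Nat.log 2 m + 1 := by
  rw [mul_comm, Nat.log_mul_base one_lt_two (by omega)]

lemma log_two_mul_add_one {m : ℕ} (hm : 1 ≤ m) : Nat.log 2 (2 * m + 1) = Nat.log 2 m + 1 := by
  rw [← Nat.log_div_mul_self, ← log_two_mul' hm]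
  congr 1
  omega

section Blocks

variable {hb rho : ℕ → ℝ}

lemma log_two_block {l i : ℕ} (hi : i < 2 ^ l) : Nat.log 2 (2 ^ l + i) = l := by
  rw [Nat.log_eq_iff (Or.inr ⟨one_lt_two, by positivity⟩), pow_succ]
  omega

/-- Within a dyadic block the digit means are equidistributed around the block average. -/
lemma abs_sum_block_le (hb0 : ∀ l, 0 ≤ hb l) (hb1 : ∀ l, hb l ≤ 1 / 2) (hr0 : ∀ l, 0 ≤ rho l)
    (hr1 : ∀ l, rho l ≤ 1 / 2) (hstart : hb 0 = rho 0)
    (hstep : ∀ l, hb (l + 1) * (1 - rho l / 2) = rho (l + 1)) (l : ℕ) :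
    ∀ j ≤ 2 ^ l, |∑ i ∈ Finset.range j,
      (meanDigit (fun k => hb (Nat.log 2 k)) (2 ^ l + i) - rho l)| ≤ 1 := by
  set r := meanDigit (fun k => hb (Nat.log 2 k)) with hr
  have hmem : ∀ k, 0 ≤ r k ∧ r k ≤ 1 :=
    meanDigit_mem (fun k => hb0 _) (fun k => (hb1 _).trans (by norm_num))
  induction l with
  | zero =>
    intro j hj
    rcases (show j = 0 ∨ j = 1 by omega) with rfl | rfl
    · simp
    · have : r 1 = rho 0 := by
        rw [hr, meanDigit_eq _ le_rfl]
        simp [hstart]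
      simp [this]
  | succ l ih =>
    have hev : ∀ i < 2 ^ l, r (2 ^ (l + 1) + 2 * i) = hb (l + 1) * (1 - r (2 ^ l + i)) := by
      intro i hi
      rw [hr, meanDigit_eq _ (by have := Nat.one_le_two_pow (n := l + 1); omega),
        log_two_block (by rw [pow_succ]; omega)]
      have h2 : 2 ^ (l + 1) + 2 * i = 2 * (2 ^ l + i) := by ring
      rw [h2, if_pos (even_two_mul _), Nat.mul_div_cancel_left _ two_pos]
    have hod : ∀ i < 2 ^ l, r (2 ^ (l + 1) + (2 * i + 1)) = hb (l + 1) := by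
      intro i hi
      rw [hr, meanDigit_eq _ (by omega), log_two_block (by rw [pow_succ]; omega), if_neg]
      · ring
      · rw [pow_succ]
        intro h
        have := h.two_dvd
        omega
    -- Pairing positions `2i` and `2i + 1` multiplies the discrepancy of the previous block by `-hb
    -- (l + 1)`, at most `1/2` in size. An unpaired last term adds at most `1/2`, so the bound `1`
    -- reproduces itself.
    have heven : ∀ j ≤ 2 ^ l, ∑ i ∈ Finset.range (2 * j), (r (2 ^ (l + 1) + i) - rho (l + 1)) =
        -hb (l + 1) * ∑ i ∈ Finset.range j, (r (2 ^ l + i) - rho l) := by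
      intro j
      induction j with
      | zero => simp
      | succ j ihj =>
        intro hj
        rw [show 2 * (j + 1) = 2 * j + 1 + 1 by ring, Finset.sum_range_succ, Finset.sum_range_succ,
          ihj (by omega), hev j (by omega), hod j (by omega), Finset.sum_range_succ, ← hstep l]
        ring
    intro j hj
    have hbl := hb1 (l + 1)
    have hbl0 := hb0 (l + 1)
    rcases Nat.even_or_odd' j with ⟨m, rfl | rfl⟩
    · have hm : m ≤ 2 ^ l := by rw [pow_succ] at hj; omega
      rw [heven m hm, abs_mul, abs_neg, abs_of_nonneg hbl0]
      have := ih m hm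
      nlinarith [abs_nonneg (∑ i ∈ Finset.range m, (r (2 ^ l + i) - rho l))]
    · have hm : m < 2 ^ l := by rw [pow_succ] at hj; omega
      rw [Finset.sum_range_succ, heven m hm.le, hev m hm]
      have h1 := ih m hm.le
      have h2 := hmem (2 ^ l + m)
      have h3 := hr0 (l + 1)
      have h4 := hr1 (l + 1)
      rw [abs_le] at h1 ⊢
      have h5 : 0 ≤ hb (l + 1) * (1 - r (2 ^ l + m)) := mul_nonneg hbl0 (by linarith)
      have h6 : hb (l + 1) * (1 - r (2 ^ l + m)) ≤ 1 / 2 := by nlinarith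
      constructor <;> nlinarith

lemma abs_sum_meanDigit_sub_le (hb0 : ∀ l, 0 ≤ hb l) (hb1 : ∀ l, hb l ≤ 1 / 2)
    (hr0 : ∀ l, 0 ≤ rho l) (hr1 : ∀ l, rho l ≤ 1 / 2) (hstart : hb 0 = rho 0)
    (hstep : ∀ l, hb (l + 1) * (1 - rho l / 2) = rho (l + 1)) (n : ℕ) :
    |∑ k ∈ Finset.Icc 1 n, meanDigit (fun k => hb (Nat.log 2 k)) k -
      ∑ k ∈ Finset.Icc 1 n, rho (Nat.log 2 k)| ≤ Nat.log 2 n + 1 := by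
  set r := meanDigit (fun k => hb (Nat.log 2 k)) with hr
  rw [← Finset.sum_sub_distrib]
  have hpart : ∀ l, ∀ j ≤ 2 ^ l,
      |∑ k ∈ Finset.Ico (2 ^ l) (2 ^ l + j), (r k - rho (Nat.log 2 k))| ≤ 1 := by
    intro l j hj
    rw [Finset.sum_Ico_eq_sum_range, Nat.add_sub_cancel_left]
    have := abs_sum_block_le hb0 hb1 hr0 hr1 hstart hstep l j hj
    rwa [Finset.sum_congr rfl (g := fun i => r (2 ^ l + i) - rho l)]
    intro i hi
    rw [Finset.mem_range] at hi
    rw [log_two_block (by omega)]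
  have hfull : ∀ l : ℕ, |∑ k ∈ Finset.Ico 1 (2 ^ l), (r k - rho (Nat.log 2 k))| ≤ l := by
    intro l
    induction l with
    | zero => simp
    | succ l ih =>
      have h1 := hpart l (2 ^ l) le_rfl
      rw [← Finset.sum_Ico_consecutive _ (Nat.one_le_two_pow (n := l))
        (show 2 ^ l ≤ 2 ^ (l + 1) by rw [pow_succ]; omega),
        show 2 ^ (l + 1) = 2 ^ l + 2 ^ l by ring]
      push_cast
      exact (abs_add_le _ _).trans (add_le_add ih h1)
  rcases Nat.eq_zero_or_pos n with rfl | hn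
  · simp
  have h1 := Nat.pow_log_le_self 2 hn.ne'
  have h2 := Nat.lt_pow_succ_log_self one_lt_two n
  have hIcc : Finset.Icc 1 n = Finset.Ico 1 (n + 1) := by
    ext k
    simp only [Finset.mem_Icc, Finset.mem_Ico]
    omega
  have h3 := hpart (Nat.log 2 n) (n + 1 - 2 ^ Nat.log 2 n) (by rw [pow_succ] at h2; omega)
  rw [show 2 ^ Nat.log 2 n + (n + 1 - 2 ^ Nat.log 2 n) = n + 1 by omega] at h3
  rw [hIcc, ← Finset.sum_Ico_consecutive _ (Nat.one_le_two_pow (n := Nat.log 2 n))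
    (show 2 ^ Nat.log 2 n ≤ n + 1 by omega)]
  exact (abs_add_le _ _).trans (add_le_add (hfull _) h3)

/-- Positions `2m` and `2m + 1` lie one block above `m`, so pairing them against twice the term at
`m` gains at least `2 * g`. The subtracted `2 * g + 1` pays for the ends. -/
lemma sum_rho_sub_ge (hr0 : ∀ l, 0 ≤ rho l) (hr1 : ∀ l, rho l ≤ 1 / 2) {g : ℝ} {n : ℕ} (hg : 0 ≤ g)
    (hinc : ∀ l ≤ Nat.log 2 n, g ≤ rho (l + 1) - rho l) :
    (n : ℝ) * g - 2 * g - 1 ≤ ∑ k ∈ Finset.Icc 1 n, rho (Nat.log 2 k) -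
      2 * ∑ k ∈ Finset.Icc 1 (n / 2), rho (Nat.log 2 k) := by
  have hodd : ∀ m, m ≤ n → 2 * (m : ℝ) * g ≤ ∑ k ∈ Finset.Icc 1 (2 * m + 1), rho (Nat.log 2 k) -
      2 * ∑ k ∈ Finset.Icc 1 m, rho (Nat.log 2 k) := by
    intro m
    induction m with
    | zero => simpa using hr0 0
    | succ m ih =>
      intro hm
      rw [show 2 * (m + 1) + 1 = 2 * m + 1 + 1 + 1 by ring, Finset.sum_Icc_succ_top (by omega),
        Finset.sum_Icc_succ_top (by omega), Finset.sum_Icc_succ_top (b := m) (by omega),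
        show 2 * m + 1 + 1 + 1 = 2 * (m + 1) + 1 by ring, show 2 * m + 1 + 1 = 2 * (m + 1) by ring,
        log_two_mul_add_one (by omega), log_two_mul' (by omega)]
      have h1 := ih (by omega)
      have h2 := hinc (Nat.log 2 (m + 1)) (Nat.log_mono_right hm)
      push_cast
      linarith
  have h1 := hodd (n / 2) (by omega)
  rcases Nat.even_or_odd' n with ⟨m, rfl | rfl⟩
  · rw [Nat.mul_div_cancel_left _ two_pos] at h1 ⊢
    rw [Finset.sum_Icc_succ_top (by omega)] at h1
    have h2 := hr1 (Nat.log 2 (2 * m + 1))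
    push_cast
    linarith
  · rw [show (2 * m + 1) / 2 = m by omega] at h1 ⊢
    push_cast
    linarith

end Blocks

lemma sum_inv_sq_log_le (n : ℕ) :
    ∑ k ∈ Finset.Icc 1 n, 1 / ((Nat.log 2 k : ℝ) + 5) ^ 2 ≤ 4 * n / ((Nat.log 2 n : ℝ) + 5) ^ 2 := by
  have hfull : ∀ l : ℕ, ∑ k ∈ Finset.Ico 1 (2 ^ (l + 1)), 1 / ((Nat.log 2 k : ℝ) + 5) ^ 2 ≤
      4 * 2 ^ l / ((l : ℝ) + 5) ^ 2 := by
    intro l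
    induction l with
    | zero => norm_num
    | succ l ih =>
      rw [← Finset.sum_Ico_consecutive _ (Nat.one_le_two_pow (n := l + 1))
        (show 2 ^ (l + 1) ≤ 2 ^ (l + 1 + 1) by rw [pow_succ _ (l + 1)]; omega)]
      have hblock : ∑ k ∈ Finset.Ico (2 ^ (l + 1)) (2 ^ (l + 1 + 1)),
          1 / ((Nat.log 2 k : ℝ) + 5) ^ 2 = 2 ^ (l + 1) / (((l + 1 : ℕ) : ℝ) + 5) ^ 2 := by
        rw [Finset.sum_congr rfl (g := fun _ => 1 / (((l + 1 : ℕ) : ℝ) + 5) ^ 2)]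
        · rw [Finset.sum_const, Nat.card_Ico, nsmul_eq_mul,
            show 2 ^ (l + 1 + 1) - 2 ^ (l + 1) = 2 ^ (l + 1) by rw [pow_succ _ (l + 1)]; omega]
          push_cast
          ring
        · intro k hk
          rw [Finset.mem_Ico] at hk
          rw [(Nat.log_eq_iff (Or.inr ⟨one_lt_two, by
            have := Nat.one_le_two_pow (n := l + 1); omega⟩)).2 hk]
      rw [hblock]
      have hl : (0 : ℝ) ≤ l := Nat.cast_nonneg l
      -- The shift `5` keeps the ratio of consecutive weights at most `36/25 < 3/2`, which closes
      -- the induction with constant `4`, since `4 * 3/2 + 2 = 8`.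
      have h1 : 1 / ((l : ℝ) + 5) ^ 2 ≤ 3 / 2 * (1 / (((l + 1 : ℕ) : ℝ) + 5) ^ 2) := by
        push_cast
        rw [mul_one_div, div_le_div_iff₀ (by positivity) (by positivity)]
        nlinarith
      have h2 : 4 * (2 : ℝ) ^ l / ((l : ℝ) + 5) ^ 2 = 4 * 2 ^ l * (1 / ((l : ℝ) + 5) ^ 2) := by ring
      have h3 := mul_le_mul_of_nonneg_left h1 (show (0 : ℝ) ≤ 4 * 2 ^ l by positivity)
      rw [h2] at ih
      calc _ ≤ 4 * 2 ^ l * (3 / 2 * (1 / (((l + 1 : ℕ) : ℝ) + 5) ^ 2)) +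
            2 ^ (l + 1) / (((l + 1 : ℕ) : ℝ) + 5) ^ 2 := by linarith
        _ = _ := by rw [pow_succ]; ring
  rcases Nat.eq_zero_or_pos n with rfl | hn
  · simp
  refine le_trans (Finset.sum_le_sum_of_subset_of_nonneg ?_ fun _ _ _ => by positivity)
    ((hfull (Nat.log 2 n)).trans ?_)
  · intro k hk
    rw [Finset.mem_Icc] at hk
    rw [Finset.mem_Ico]
    exact ⟨hk.1, lt_of_le_of_lt hk.2 (Nat.lt_pow_succ_log_self one_lt_two n)⟩
  · gcongr
    exact_mod_cast Nat.pow_log_le_self 2 hn.ne'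

lemma log_one_sub_of_cube_eq {p : ℝ} (hp : p ^ 3 = (1 - p) ^ 2) :
    Real.log (1 - p) = 3 / 2 * Real.log p := by
  have := congrArg Real.log hp
  rw [Real.log_pow, Real.log_pow] at this
  push_cast at this
  linarith

lemma half_lt_of_cube_eq {p : ℝ} (hp0 : 0 < p) (hp : p ^ 3 = (1 - p) ^ 2) : 1 / 2 < p := by
  by_contra! h
  nlinarith [mul_pos hp0 hp0]

lemma sum_sq_sub_le {q R η : ℝ} {hb : ℕ → ℝ} (hR0 : 0 < R) (hRle : R ≤ q) (hq1 : q < 1 / 2)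
    (hblow : ∀ l, R / 2 ≤ hb l) (hbup : ∀ l, hb l ≤ q)
    (hdelta : ∀ l : ℕ, (hb (l + 1) - q) ^ 2 ≤ 9 * η ^ 2 * (1 / (((l + 1 : ℕ) : ℝ) + 5) ^ 2))
    (n : ℕ) : ∑ k ∈ Finset.Icc 1 n, (hb (Nat.log 2 k) - q) ^ 2 ≤
      1 + 9 * η ^ 2 * (4 * n / ((Nat.log 2 n : ℝ) + 5) ^ 2) := by
  have h1 := sum_inv_sq_log_le n
  have h2 : ∀ k ∈ Finset.Icc 1 n, (hb (Nat.log 2 k) - q) ^ 2 ≤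
      -- Block `0` consists of `k = 1` alone; its bias is not covered by `hdelta`, so its term is
      -- bounded by `1`.
      (if k = 1 then 1 else 0) + 9 * η ^ 2 * (1 / ((Nat.log 2 k : ℝ) + 5) ^ 2) := by
    intro k hk
    rw [Finset.mem_Icc] at hk
    rcases hk.1.eq_or_lt with rfl | hk1
    · have h3 := hblow (Nat.log 2 1)
      have h4 := hbup (Nat.log 2 1)
      have h5 : 0 ≤ 9 * η ^ 2 * (1 / ((Nat.log 2 1 : ℝ) + 5) ^ 2) := by positivity
      rw [if_pos rfl]
      have h6 : ∀ x, R / 2 ≤ x → x ≤ q → (x - q) ^ 2 ≤ 1 := by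
        intro x hx hx'
        rw [sq_le_one_iff_abs_le_one, abs_le]
        constructor <;> linarith
      exact le_add_of_le_of_nonneg (h6 _ h3 h4) h5
    · rw [if_neg (by omega), zero_add]
      have h3 : 0 < Nat.log 2 k := Nat.log_pos one_lt_two hk1
      obtain ⟨l, hl⟩ : ∃ l, Nat.log 2 k = l + 1 := ⟨Nat.log 2 k - 1, by omega⟩
      rw [hl]
      exact hdelta l
  refine (Finset.sum_le_sum h2).trans ?_
  rw [Finset.sum_add_distrib, ← Finset.mul_sum]
  refine add_le_add ?_ (mul_le_mul_of_nonneg_left h1 (by positivity))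
  rw [Finset.sum_ite_eq']
  split_ifs <;> norm_num

/-- Biases on dyadic blocks that realise the block averages `R - η / (l + 6)`. -/
lemma exists_blocks {q R η : ℝ} (hq0 : 0 < q) (hq1 : q < 1 / 2) (hR0 : 0 < R)
    (hRq : q * (1 - R / 2) = R) (hRle : R ≤ q) (hη0 : 0 < η) (hηR : η ≤ R) :
    ∃ hb rho : ℕ → ℝ, hb 0 = rho 0 ∧ (∀ l, hb (l + 1) * (1 - rho l / 2) = rho (l + 1)) ∧
      (∀ l, R / 2 ≤ rho l) ∧ (∀ l, rho l ≤ R) ∧ (∀ l, R / 2 ≤ hb l) ∧ (∀ l, hb l ≤ q) ∧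
      (∀ l : ℕ, rho (l + 1) - rho l = η / (((l : ℝ) + 6) * ((l : ℝ) + 7))) ∧
      ∀ l : ℕ, (hb (l + 1) - q) ^ 2 ≤ 9 * η ^ 2 * (1 / (((l + 1 : ℕ) : ℝ) + 5) ^ 2) := by
  -- This profile makes the increments of `rho` and the squared bias errors both of order `1 / l^2`,
  -- the former linear and the latter quadratic in `η`.
  set rho : ℕ → ℝ := fun l => R - η / ((l : ℝ) + 6) with hrho
  have hηle : ∀ l : ℕ, η / ((l : ℝ) + 6) ≤ R / 2 := by
    intro l
    rw [div_le_iff₀ (by positivity)]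
    have : (0 : ℝ) ≤ l := Nat.cast_nonneg l
    nlinarith
  have hηpos : ∀ l : ℕ, 0 < η / ((l : ℝ) + 6) := fun l => by positivity
  have hrlow : ∀ l, R / 2 ≤ rho l := fun l => by
    have := hηle l
    simp only [hrho]
    linarith
  have hrup : ∀ l, rho l ≤ R := fun l => by
    have := hηpos l
    simp only [hrho]
    linarith
  -- The recursion forces every bias above level `0`: in block `l + 1` half of the positions are
  -- odd, hence never blocked, and the average unblocked fraction is `1 - rho l / 2`.
  set hb : ℕ → ℝ := fun l => Nat.casesOn l (rho 0) fun l => rho (l + 1) / (1 - rho l / 2) with hhb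
  have hden : ∀ l, 3 / 4 ≤ 1 - rho l / 2 := fun l => by have := hrup l; linarith
  have hstep : ∀ l, hb (l + 1) * (1 - rho l / 2) = rho (l + 1) := fun l => by
    have := hden l
    simp only [hhb]
    exact div_mul_cancel₀ _ (by linarith)
  have hblow : ∀ l, R / 2 ≤ hb l := by
    intro l
    rcases l with _ | l
    · exact hrlow 0
    · have h1 := hstep l
      have h2 := hden l
      have h3 := hrlow (l + 1)
      have h4 := hrlow l
      by_contra! hlt
      nlinarith
  have hdelta : ∀ l : ℕ, (hb (l + 1) - q) ^ 2 ≤ 9 * η ^ 2 * (1 / (((l + 1 : ℕ) : ℝ) + 5) ^ 2) := by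
    intro l
    have h1 := hstep l
    have h2 := hden l
    have h3 : (q - hb (l + 1)) * (1 - rho l / 2) =
        q * (η / ((l : ℝ) + 6)) / 2 + η / (((l + 1 : ℕ) : ℝ) + 6) := by
      rw [sub_mul, h1]
      simp only [hrho]
      linarith
    have h4 : η / (((l + 1 : ℕ) : ℝ) + 6) ≤ η / ((l : ℝ) + 6) := by
      gcongr
      linarith
    have h5 := hηpos l
    have h6 := hηpos (l + 1)
    have h7 : 0 ≤ q - hb (l + 1) := by
      by_contra! hlt
      nlinarith
    have h8 : q - hb (l + 1) ≤ 3 * (η / ((l : ℝ) + 6)) := by nlinarith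
    have h9 : 9 * η ^ 2 * (1 / (((l + 1 : ℕ) : ℝ) + 5) ^ 2) = (3 * (η / ((l : ℝ) + 6))) ^ 2 := by
      push_cast
      rw [show (l : ℝ) + 1 + 5 = l + 6 by ring, mul_pow, div_pow]
      ring
    rw [h9, ← neg_sub, neg_sq]
    exact pow_le_pow_left₀ h7 h8 2
  have hbup : ∀ l, hb l ≤ q := by
    intro l
    rcases l with _ | l
    · exact (hrup 0).trans hRle
    · have h1 := hstep l
      have h2 := hden l
      have h3 := hrup (l + 1)
      have h4 := hrup l
      by_contra! hlt
      nlinarith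
  refine ⟨hb, rho, rfl, hstep, hrlow, hrup, hblow, hbup, fun l => ?_, hdelta⟩
  simp only [hrho]
  push_cast
  field_simp
  ring

/-- With `z = n / (log₂ n + 7)^2`, the density growth gains `(L/2) η z` up to logarithmic errors,
and the entropy loss is at most `72 η^2 z / (q p)` plus a constant. By `hηL` this eats at most half
of the gain. -/
lemma meanSurprisal_blocks_ge {p q R η L : ℝ} {hb rho : ℕ → ℝ} (hp0 : 0 < p) (hp1 : p < 1)
    (hlog : Real.log (1 - p) = 3 / 2 * Real.log p) (hL : 0 < L) (hLdef : L = -Real.log p)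
    (hq : q = 1 - p) (hq0 : 0 < q) (hq1 : q < 1 / 2) (hR0 : 0 < R) (hRle : R ≤ q) (hη0 : 0 < η)
    (hηR : η ≤ R) (hηL : 72 * η / (q * p) ≤ L / 4) (hstart : hb 0 = rho 0)
    (hstep : ∀ l, hb (l + 1) * (1 - rho l / 2) = rho (l + 1)) (hrlow : ∀ l, R / 2 ≤ rho l)
    (hrup : ∀ l, rho l ≤ R) (hblow : ∀ l, R / 2 ≤ hb l) (hbup : ∀ l, hb l ≤ q)
    (hinc : ∀ l : ℕ, rho (l + 1) - rho l = η / (((l : ℝ) + 6) * ((l : ℝ) + 7)))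
    (hdelta : ∀ l : ℕ, (hb (l + 1) - q) ^ 2 ≤ 9 * η ^ 2 * (1 / (((l + 1 : ℕ) : ℝ) + 5) ^ 2))
    (n : ℕ) : n * L + L * η / 4 * (n / ((Nat.log 2 n : ℝ) + 7) ^ 2)
        - (3 * L + 1 / (q * p)) * ((Nat.log 2 n : ℝ) + 1) ≤
      meanSurprisal (fun k => hb (Nat.log 2 k)) n := by
  have hrho0 : ∀ l, 0 ≤ rho l := fun l => by linarith [hrlow l]
  have hrho1 : ∀ l, rho l ≤ 1 / 2 := fun l => by linarith [hrup l]
  have hmean := meanSurprisal_ge hp0 hp1 hlog (h := fun k => hb (Nat.log 2 k))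
    (fun k => by linarith [hblow (Nat.log 2 k)]) (fun k => by linarith [hbup (Nat.log 2 k)]) n
  have hE := abs_sum_meanDigit_sub_le (hb := hb) (rho := rho) (fun l => by linarith [hblow l])
    (fun l => by linarith [hbup l]) hrho0 hrho1 hstart hstep
  have hE1 := abs_le.1 (hE n)
  have hE2 := abs_le.1 (hE (n / 2))
  have hlogle : (Nat.log 2 (n / 2) : ℝ) ≤ Nat.log 2 n := by
    exact_mod_cast Nat.log_mono_right (Nat.div_le_self n 2)
  obtain ⟨y, hy⟩ : ∃ y : ℝ, y = Nat.log 2 n := ⟨_, rfl⟩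
  have hy0 : 0 ≤ y := by rw [hy]; positivity
  have hD := sum_rho_sub_ge hrho0 hrho1 (g := η / ((y + 6) * (y + 7))) (n := n) (by positivity) (by
    intro l hl
    have hl' : (l : ℝ) ≤ y := by rw [hy]; exact_mod_cast hl
    have hl0 : (0 : ℝ) ≤ l := Nat.cast_nonneg l
    rw [hinc]
    gcongr)
  have hsq := sum_sq_sub_le hR0 hRle hq1 hblow hbup hdelta n
  rw [← hy] at hsq
  rw [← hq, ← hLdef] at hmean
  rw [← hy] at hE1 hlogle ⊢
  have hg1 : η / ((y + 6) * (y + 7)) ≤ 1 := by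
    rw [div_le_one (by positivity)]
    nlinarith
  have hg2 : η * (1 / (y + 7) ^ 2) ≤ η / ((y + 6) * (y + 7)) := by
    rw [mul_one_div]
    apply div_le_div_of_nonneg_left hη0.le (by positivity)
    nlinarith
  have hg3 : 1 / (y + 5) ^ 2 ≤ 2 * (1 / (y + 7) ^ 2) := by
    rw [mul_one_div, div_le_div_iff₀ (by positivity) (by positivity)]
    nlinarith
  have hn0 : (0 : ℝ) ≤ n := Nat.cast_nonneg n
  set z := (n : ℝ) * (1 / (y + 7) ^ 2) with hz
  have hz0 : 0 ≤ z := by positivity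
  have hsq2 : (∑ k ∈ Finset.Icc 1 n, (hb (Nat.log 2 k) - q) ^ 2) / (q * p) ≤
      1 / (q * p) + L * η / 4 * z := by
    have h1 : 9 * η ^ 2 * (4 * n / (y + 5) ^ 2) ≤ 72 * η ^ 2 * z := by
      have := mul_le_mul_of_nonneg_left hg3 (show 0 ≤ 36 * η ^ 2 * n by positivity)
      calc _ = 36 * η ^ 2 * n * (1 / (y + 5) ^ 2) := by ring
        _ ≤ _ := this
        _ = _ := by rw [hz]; ring
    calc _ ≤ (1 + 72 * η ^ 2 * z) / (q * p) := by gcongr; linarith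
      _ = 1 / (q * p) + (72 * η / (q * p)) * (η * z) := by ring
      _ ≤ 1 / (q * p) + L / 4 * (η * z) := by gcongr
      _ = _ := by ring
  have hD2 : η * z - 3 * (y + 1) - 3 ≤
      ∑ k ∈ Finset.Icc 1 n, meanDigit (fun k => hb (Nat.log 2 k)) k -
      2 * ∑ k ∈ Finset.Icc 1 (n / 2), meanDigit (fun k => hb (Nat.log 2 k)) k := by
    have h1 := mul_le_mul_of_nonneg_left hg2 hn0
    have h2 : (n : ℝ) * (η * (1 / (y + 7) ^ 2)) = η * z := by rw [hz]; ring
    linarith [hE1.1, hE2.2]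
  have h3 := mul_le_mul_of_nonneg_left hD2 (show 0 ≤ L / 2 by positivity)
  have h4 : (n : ℝ) / (y + 7) ^ 2 = z := by rw [hz]; ring
  rw [h4]
  have h5 : 0 ≤ 1 / (q * p) * y := by positivity
  nlinarith [mul_nonneg hL.le hy0]

/-- Biases slowly approaching the stationary ones from below give an expected surprisal
exceeding the stationary rate by a multiple of `n / (log n) ^ 2`. -/
lemma exists_bias {p : ℝ} (hp0 : 0 < p) (hp1 : p < 1) (hp : p ^ 3 = (1 - p) ^ 2) :
    ∃ (h : ℕ → unitInterval) (κ W C : ℝ), 0 < κ ∧ (∀ k, 0 < (h k : ℝ)) ∧ (∀ k, (h k : ℝ) < 1) ∧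
      (∀ k, |Real.log (h k)| ≤ W) ∧ (∀ k, |Real.log (1 - h k)| ≤ W) ∧
      ∀ n : ℕ, n * (-Real.log p) + κ * (n / ((Nat.log 2 n : ℝ) + 7) ^ 2)
        - C * ((Nat.log 2 n : ℝ) + 1) ≤ meanSurprisal (fun k => h k) n := by
  have hlog := log_one_sub_of_cube_eq hp
  have hhalf := half_lt_of_cube_eq hp0 hp
  have hL : 0 < -Real.log p := neg_pos.2 (Real.log_neg hp0 hp1)
  set L := -Real.log p with hLdef
  obtain ⟨q, hq⟩ : ∃ q, q = 1 - p := ⟨_, rfl⟩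
  have hq0 : 0 < q := by linarith
  have hq1 : q < 1 / 2 := by linarith
  -- The stationary density of ones for the constant bias `q`: the fixed point of `R = q (1 - R /
  -- 2)`.
  obtain ⟨R, hR⟩ : ∃ R, R = 2 * q / (2 + q) := ⟨_, rfl⟩
  have hR0 : 0 < R := by rw [hR]; positivity
  have hRq : q * (1 - R / 2) = R := by rw [hR]; field_simp; ring
  have hRle : R ≤ q := by nlinarith
  obtain ⟨η, hη0, hηR, hηL⟩ : ∃ η : ℝ, 0 < η ∧ η ≤ R ∧ 72 * η / (q * p) ≤ L / 4 := by
    refine ⟨min R (L * (q * p) / 288), lt_min hR0 (by positivity), min_le_left _ _, ?_⟩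
    rw [div_le_iff₀ (by positivity)]
    have := min_le_right R (L * (q * p) / 288)
    linarith
  obtain ⟨hb, rho, hstart, hstep, hrlow, hrup, hblow, hbup, hinc, hdelta⟩ :=
    exists_blocks hq0 hq1 hR0 hRq hRle hη0 hηR
  refine ⟨fun k => ⟨hb (Nat.log 2 k), by linarith [hblow (Nat.log 2 k)],
    by linarith [hbup (Nat.log 2 k)]⟩, L * η / 4, -Real.log (R / 2), 3 * L + 1 / (q * p),
    by positivity, fun k => by linarith [hblow (Nat.log 2 k)],
    fun k => by linarith [hbup (Nat.log 2 k)], fun k => ?_, fun k => ?_, fun n => ?_⟩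
  · have h1 := hblow (Nat.log 2 k)
    have h2 := hbup (Nat.log 2 k)
    rw [abs_of_nonpos (Real.log_nonpos (by linarith) (by linarith))]
    exact neg_le_neg (Real.log_le_log (by positivity) h1)
  · have h1 := hblow (Nat.log 2 k)
    have h2 := hbup (Nat.log 2 k)
    simp only
    rw [abs_of_nonpos (Real.log_nonpos (by linarith) (by linarith))]
    exact neg_le_neg (Real.log_le_log (by positivity) (by linarith))
  exact meanSurprisal_blocks_ge hp0 hp1 hlog hL hLdef hq hq0 hq1 hR0 hRle hη0 hηR hηL hstart hstep
    hrlow hrup hblow hbup hinc hdelta n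

/-! ### Fluctuations: from the mean to almost every sequence -/

/-- The fifth power is what Chebyshev leaves: a variance of order `n log n` over the square of a
threshold of order `n / (log n)^2`. -/
lemma log_add_seven_pow_le {n : ℕ} (hn : 1 ≤ n) :
    ((Nat.log 2 n : ℝ) + 7) ^ 5 ≤ 47 ^ 5 * (n : ℝ) ^ (1 / 4 : ℝ) := by
  have hn' : (1 : ℝ) ≤ n := by exact_mod_cast hn
  have h1 : (Nat.log 2 n : ℝ) ≤ Real.logb 2 n := Real.natLog_le_logb n 2
  have h2 := Real.log_le_rpow_div (x := n) (by linarith) (show (0 : ℝ) < 1 / 20 by norm_num)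
  have h3 : Real.logb 2 n ≤ 40 * (n : ℝ) ^ (1 / 20 : ℝ) := by
    rw [Real.logb, div_le_iff₀ (Real.log_pos one_lt_two)]
    have h4 : (1 : ℝ) / 2 ≤ Real.log 2 := by linarith [Real.log_two_gt_d9]
    have h5 : 0 ≤ (n : ℝ) ^ (1 / 20 : ℝ) := by positivity
    nlinarith
  have h4 : 1 ≤ (n : ℝ) ^ (1 / 20 : ℝ) := Real.one_le_rpow hn' (by norm_num)
  calc ((Nat.log 2 n : ℝ) + 7) ^ 5 ≤ (47 * (n : ℝ) ^ (1 / 20 : ℝ)) ^ 5 := by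
        gcongr
        linarith
    _ = 47 ^ 5 * (n : ℝ) ^ (1 / 4 : ℝ) := by
        rw [mul_pow, ← Real.rpow_natCast ((n : ℝ) ^ (1 / 20 : ℝ)), ← Real.rpow_mul (by linarith)]
        norm_num

lemma tendsto_log_add_seven_pow_div :
    Tendsto (fun n : ℕ => ((Nat.log 2 n : ℝ) + 7) ^ 5 / n) atTop (𝓝 0) := by
  have h1 : Tendsto (fun n : ℕ => (47 : ℝ) ^ 5 * (n : ℝ) ^ (-(3 / 4) : ℝ)) atTop (𝓝 0) := by
    have := ((tendsto_rpow_neg_atTop (show (0 : ℝ) < 3 / 4 by norm_num)).comp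
      tendsto_natCast_atTop_atTop).const_mul ((47 : ℝ) ^ 5)
    simpa using this
  refine squeeze_zero' (Eventually.of_forall fun n => by positivity) ?_ h1
  filter_upwards [eventually_ge_atTop 1] with n hn
  have hn' : (0 : ℝ) < n := by exact_mod_cast hn
  have h2 : (n : ℝ) ^ (-(3 / 4) : ℝ) * n = (n : ℝ) ^ (1 / 4 : ℝ) := by
    rw [← Real.rpow_add_one hn'.ne']
    norm_num
  rw [div_le_iff₀ hn', mul_assoc, h2]
  exact log_add_seven_pow_le hn

/-- This is the reason for sampling along squares: `(log n)^5 / n` is not summable over all `n`, but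
is over `n = j^2`. -/
lemma summable_log_add_seven_pow_div_sq :
    Summable fun j : ℕ => ((Nat.log 2 (j ^ 2) : ℝ) + 7) ^ 5 / ((j ^ 2 : ℕ) : ℝ) := by
  have h1 : Summable fun j : ℕ => (47 : ℝ) ^ 5 * (j : ℝ) ^ (-(3 / 2) : ℝ) :=
    (Real.summable_nat_rpow.2 (by norm_num)).mul_left _
  refine Summable.of_norm_bounded_eventually_nat h1 ?_
  filter_upwards [eventually_ge_atTop 1] with j hj
  have hj' : (0 : ℝ) < j := by exact_mod_cast hj
  rw [Real.norm_of_nonneg (by positivity), div_le_iff₀ (by positivity)]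
  refine (log_add_seven_pow_le (Nat.one_le_pow _ _ hj)).trans (le_of_eq ?_)
  push_cast
  rw [mul_assoc, ← Real.rpow_natCast (j : ℝ) 2, ← Real.rpow_mul hj'.le, ← Real.rpow_add hj']
  norm_num

lemma variance_surprisal_le (h : ℕ → unitInterval) {W : ℝ} (hW1 : ∀ k, |Real.log (h k)| ≤ W)
    (hW2 : ∀ k, |Real.log (1 - h k)| ≤ W) (n : ℕ) :
    MemLp (fun b => surprisal (fun k => h k) (goldenDigit b) n) 2 (bitMeasure h) ∧
    ∫ b, surprisal (fun k => h k) (goldenDigit b) n ∂(bitMeasure h) =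
      meanSurprisal (fun k => h k) n ∧
    Var[fun b => surprisal (fun k => h k) (goldenDigit b) n; bitMeasure h] ≤
      (3 * W) ^ 2 * (n * (Nat.log 2 n + 1)) := by
  have hW : 0 ≤ W := (abs_nonneg _).trans (hW1 0)
  have hint : ∀ k, Integrable (fun b => digitVal (goldenDigit b) k) (bitMeasure h) :=
    fun k => (memLp_digitVal h k 1).integrable le_rfl
  set A : ℝ := ∑ k ∈ Finset.Icc 1 n, (-Real.log (1 - (h k : ℝ))) with hA
  -- Both digit sums are merged into one with weights of size at most `3W`, so that the variance
  -- bound for weighted digit sums applies.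
  set w : ℕ → ℝ := fun k => (Real.log (1 - (h k : ℝ)) - Real.log (h k)) +
    if k ≤ n / 2 then Real.log (1 - (h (2 * k) : ℝ)) else 0 with hw
  have hsum : ∀ d : ℕ → ℝ, ∑ k ∈ Finset.Icc 1 n, w k * d k =
      ∑ k ∈ Finset.Icc 1 n, (Real.log (1 - (h k : ℝ)) - Real.log (h k)) * d k +
        ∑ m ∈ Finset.Icc 1 (n / 2), Real.log (1 - (h (2 * m) : ℝ)) * d m := by
    intro d
    have hsub : Finset.Icc 1 (n / 2) = (Finset.Icc 1 n).filter (fun k => k ≤ n / 2) := by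
      ext k
      simp only [Finset.mem_Icc, Finset.mem_filter]
      omega
    rw [hsub, Finset.sum_filter, ← Finset.sum_add_distrib]
    refine Finset.sum_congr rfl fun k _ => ?_
    simp only [hw]
    split_ifs <;> ring
  have hfun : (fun b => surprisal (fun k => h k) (goldenDigit b) n) =
      fun b => A + ∑ k ∈ Finset.Icc 1 n, w k * digitVal (goldenDigit b) k := by
    funext b
    rw [surprisal_eq _ (isGolden_goldenDigit b), hsum, hA]
    ring
  have hmem : MemLp (fun b => ∑ k ∈ Finset.Icc 1 n, w k * digitVal (goldenDigit b) k) 2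
      (bitMeasure h) := memLp_finsetSum _ fun k _ => (memLp_digitVal h k 2).const_mul _
  rw [hfun]
  refine ⟨(memLp_const A).add hmem, ?_, ?_⟩
  · rw [integral_add (integrable_const _) (integrable_finsetSum _ fun k _ => (hint k).const_mul _),
      integral_finsetSum _ fun k _ => (hint k).const_mul _]
    simp_rw [integral_const_mul, integral_digitVal]
    rw [hsum, meanSurprisal, hA]
    simp
    ring
  · rw [variance_const_add hmem.aestronglyMeasurable]
    refine variance_sum_digitVal_le h n w fun k => ?_
    simp only [hw]
    have h1 := abs_le.1 (hW1 k)
    have h2 := abs_le.1 (hW2 k)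
    have h3 := abs_le.1 (hW2 (2 * k))
    rw [abs_le]
    split_ifs <;> constructor <;> linarith

/-- Almost surely the surprisal along the squares exceeds the stationary rate. -/
lemma exists_bias_ae {p : ℝ} (hp0 : 0 < p) (hp1 : p < 1) (hp : p ^ 3 = (1 - p) ^ 2) :
    ∃ (h : ℕ → unitInterval) (κ : ℝ), 0 < κ ∧ (∀ k, 0 < (h k : ℝ)) ∧ (∀ k, (h k : ℝ) < 1) ∧
      ∀ᵐ b ∂(bitMeasure h), ∀ᶠ j : ℕ in atTop,
        ((j ^ 2 : ℕ) : ℝ) * (-Real.log p) +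
          κ * (((j ^ 2 : ℕ) : ℝ) / ((Nat.log 2 (j ^ 2) : ℝ) + 7) ^ 2) ≤
        surprisal (fun k => h k) (goldenDigit b) (j ^ 2) := by
  obtain ⟨h, κ, W, C, hκ, h0, h1, hW1, hW2, hmean⟩ := exists_bias hp0 hp1 hp
  refine ⟨h, κ / 4, by positivity, h0, h1, ?_⟩
  have hvar := variance_surprisal_le h hW1 hW2
  set S : ℕ → (ℕ → Bool) → ℝ := fun n b => surprisal (fun k => h k) (goldenDigit b) n with hS
  -- Of the mean gain `κ`, one half is given up to fluctuations and a quarter to the logarithmic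
  -- error; `κ / 4` survives.
  set t : ℕ → ℝ := fun n => κ / 2 * ((n : ℝ) / ((Nat.log 2 n : ℝ) + 7) ^ 2) with ht
  have hprob : ∀ j : ℕ, 1 ≤ j → bitMeasure h {b | t (j ^ 2) ≤
      |S (j ^ 2) b - ∫ b, S (j ^ 2) b ∂(bitMeasure h)|} ≤
      ENNReal.ofReal (36 * W ^ 2 / κ ^ 2 *
        (((Nat.log 2 (j ^ 2) : ℝ) + 7) ^ 5 / ((j ^ 2 : ℕ) : ℝ))) := by
    intro j hj
    have hn : (0 : ℝ) < ((j ^ 2 : ℕ) : ℝ) := by exact_mod_cast pow_pos hj 2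
    refine (meas_ge_le_variance_div_sq (hvar (j ^ 2)).1 (by simp only [ht]; positivity)).trans ?_
    refine ENNReal.ofReal_le_ofReal ?_
    refine (div_le_div_of_nonneg_right (hvar (j ^ 2)).2.2 (sq_nonneg _)).trans ?_
    simp only [ht]
    have hl : (0 : ℝ) ≤ Nat.log 2 (j ^ 2) := Nat.cast_nonneg _
    generalize (Nat.log 2 (j ^ 2) : ℝ) = l at *
    generalize ((j ^ 2 : ℕ) : ℝ) = n at *
    calc (3 * W) ^ 2 * (n * (l + 1)) / (κ / 2 * (n / (l + 7) ^ 2)) ^ 2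
        = 36 * W ^ 2 / κ ^ 2 * ((l + 1) * (l + 7) ^ 4 / n) := by field_simp; ring
      _ ≤ 36 * W ^ 2 / κ ^ 2 * ((l + 7) * (l + 7) ^ 4 / n) := by gcongr; norm_num
      _ = _ := by ring
  have hsummable : ∑' j, bitMeasure h {b | t ((j + 1) ^ 2) ≤
      |S ((j + 1) ^ 2) b - ∫ b, S ((j + 1) ^ 2) b ∂(bitMeasure h)|} ≠ ∞ := by
    refine ne_top_of_le_ne_top ?_ (ENNReal.tsum_le_tsum fun j => hprob (j + 1) (by omega))
    have := ((summable_nat_add_iff 1).2 summable_log_add_seven_pow_div_sq).mul_left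
      (36 * W ^ 2 / κ ^ 2)
    exact this.tsum_ofReal_ne_top
  have hsmall : ∀ᶠ n : ℕ in atTop, C * ((Nat.log 2 n : ℝ) + 1) ≤
      κ / 4 * ((n : ℝ) / ((Nat.log 2 n : ℝ) + 7) ^ 2) := by
    have h2 := tendsto_log_add_seven_pow_div.const_mul |C|
    rw [mul_zero] at h2
    filter_upwards [h2.eventually (gt_mem_nhds (show 0 < κ / 4 by positivity)),
      eventually_ge_atTop 1] with n hn hn1
    have hn' : (0 : ℝ) < n := by exact_mod_cast hn1
    have hl : (0 : ℝ) ≤ Nat.log 2 n := Nat.cast_nonneg _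
    generalize (Nat.log 2 n : ℝ) = l at *
    rw [← mul_div_assoc, div_lt_iff₀ hn'] at hn
    rw [← mul_div_assoc, le_div_iff₀ (by positivity)]
    refine le_trans ?_ hn.le
    calc C * (l + 1) * (l + 7) ^ 2 ≤ |C| * (l + 7) * (l + 7) ^ 2 := by
          gcongr
          · exact le_abs_self C
          · norm_num
      _ = |C| * (l + 7) ^ 3 := by ring
      _ ≤ |C| * (l + 7) ^ 5 := by
          gcongr
          · linarith
          · norm_num
  filter_upwards [ae_eventually_notMem hsummable] with b hb
  have hb' : ∀ᶠ j : ℕ in atTop, |S (j ^ 2) b - ∫ b, S (j ^ 2) b ∂(bitMeasure h)| < t (j ^ 2) := by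
    obtain ⟨N, hN⟩ := eventually_atTop.1 hb
    filter_upwards [eventually_ge_atTop (N + 1)] with j hj
    have := hN (j - 1) (by omega)
    rw [Nat.sub_add_cancel (by omega)] at this
    simpa using this
  filter_upwards [hb', (tendsto_pow_atTop two_ne_zero).eventually hsmall] with j hj1 hj2
  have h3 := hmean (j ^ 2)
  rw [← (hvar (j ^ 2)).2.1] at h3
  have h4 := (abs_lt.1 hj1).1
  simp only [ht, hS] at h4 ⊢
  linarith

/-! ### Binary expansions and the mass distribution principle -/

/-- The integer with binary digits `a 1, …, a n`, most significant first. -/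
def wordCode (a : ℕ → Bool) : ℕ → ℕ
  | 0 => 0
  | n + 1 => 2 * wordCode a n + (a (n + 1)).toNat

/-- The real number with binary digits `a 1, a 2, …`. -/
noncomputable def binaryReal (a : ℕ → Bool) : ℝ := ∑' k : ℕ, digitVal a (k + 1) / 2 ^ (k + 1)

lemma hasSum_binaryReal (a : ℕ → Bool) :
    HasSum (fun k : ℕ => digitVal a (k + 1) / 2 ^ (k + 1)) (binaryReal a) := by
  refine Summable.hasSum (Summable.of_nonneg_of_le
    (fun k => div_nonneg (digitVal_nonneg _ _) (by positivity)) (fun k => ?_)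
    ((summable_nat_add_iff 1).2 summable_geometric_two))
  rw [div_pow, one_pow]
  gcongr
  exact digitVal_le_one _ _

lemma sum_range_digitVal (a : ℕ → Bool) (n : ℕ) :
    ∑ k ∈ Finset.range n, digitVal a (k + 1) / 2 ^ (k + 1) = wordCode a n / 2 ^ n := by
  induction n with
  | zero => simp [wordCode]
  | succ n ih =>
    rw [Finset.sum_range_succ, ih, wordCode, digitVal]
    rcases a (n + 1) <;> simp [pow_succ] <;> field_simp

lemma binaryReal_mem (a : ℕ → Bool) (n : ℕ) :
    (wordCode a n : ℝ) / 2 ^ n ≤ binaryReal a ∧ binaryReal a ≤ (wordCode a n + 1 : ℝ) / 2 ^ n := by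
  rw [← sum_range_digitVal, add_div, ← sum_range_digitVal]
  have hs := hasSum_binaryReal a
  constructor
  · exact sum_le_hasSum _ (fun k _ => div_nonneg (digitVal_nonneg _ _) (by positivity)) hs
  · rw [binaryReal, ← hs.summable.sum_add_tsum_nat_add n]
    have hgeo : HasSum (fun k : ℕ => 1 / (2 : ℝ) ^ (n + 1) * (1 / 2) ^ k) (1 / 2 ^ n) := by
      have := hasSum_geometric_two.mul_left (1 / (2 : ℝ) ^ (n + 1))
      rwa [show 1 / (2 : ℝ) ^ (n + 1) * 2 = 1 / 2 ^ n by rw [pow_succ]; field_simp] at this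
    rw [← hgeo.tsum_eq]
    refine add_le_add_right (Summable.tsum_le_tsum (fun k => ?_)
      ((summable_nat_add_iff n).2 hs.summable) hgeo.summable) _
    have h1 : 1 / (2 : ℝ) ^ (n + 1) * (1 / 2) ^ k = 1 / 2 ^ (k + n + 1) := by
      rw [div_pow, one_pow, div_mul_div_comm, ← pow_add]
      ring_nf
    rw [h1]
    gcongr
    exact digitVal_le_one _ _

lemma wordCode_injective {a a' : ℕ → Bool} {n : ℕ} (h : wordCode a n = wordCode a' n) :
    ∀ k ∈ Finset.Icc 1 n, a k = a' k := by
  induction n with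
  | zero => simp
  | succ n ih =>
    rw [wordCode, wordCode] at h
    have h1 := Bool.toNat_lt (a (n + 1))
    have h2 := Bool.toNat_lt (a' (n + 1))
    have h3 : wordCode a n = wordCode a' n := by omega
    have h4 : a (n + 1) = a' (n + 1) := by
      have h5 : (a (n + 1)).toNat = (a' (n + 1)).toNat := by omega
      revert h5
      rcases a (n + 1) <;> rcases a' (n + 1) <;> simp
    intro k hk
    rw [Finset.mem_Icc] at hk
    rcases hk.2.eq_or_lt with rfl | hlt
    · exact h4
    · exact ih h3 k (Finset.mem_Icc.2 ⟨hk.1, by omega⟩)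

lemma wordCode_congr {a a' : ℕ → Bool} {n : ℕ} (h : ∀ k ∈ Finset.Icc 1 n, a k = a' k) :
    wordCode a n = wordCode a' n := by
  induction n with
  | zero => rfl
  | succ n ih =>
    rw [wordCode, wordCode, h (n + 1) (by simp), ih]
    intro k hk
    rw [Finset.mem_Icc] at hk
    exact h k (Finset.mem_Icc.2 ⟨hk.1, by omega⟩)

lemma mem_XiG_iff {x : ℝ} :
    x ∈ XiG ↔ ∃ a : ℕ → Bool, IsGolden a ∧ a 0 = false ∧ x = binaryReal a := by
  constructor
  · rintro ⟨a, h01, hgold, hsum⟩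
    refine ⟨fun k => if k = 0 then false else decide (a k = 1), fun k hk h => ?_, by simp, ?_⟩
    · have hk0 : k ≠ 0 := by omega
      have hk1 : 2 * k ≠ 0 := by omega
      simp only [hk0, hk1, if_false, decide_eq_true_eq, decide_eq_false_iff_not] at h ⊢
      have := hgold k hk
      rw [h] at this
      omega
    · refine hsum.unique ?_
      convert hasSum_binaryReal _ using 3 with k
      rcases h01 (k + 1) with h | h <;> simp [digitVal, h]
  · rintro ⟨a, hgold, -, rfl⟩
    refine ⟨fun k => (a k).toNat, fun k => ?_, fun k hk => ?_, ?_⟩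
    · rcases a k <;> simp
    · rcases h : a k
      · simp [h]
      · simp [hgold k hk h]
    · convert hasSum_binaryReal a using 3 with k
      rcases h : a (k + 1) <;> simp [digitVal, h]

lemma binaryReal_goldenDigit_mem (b : ℕ → Bool) : binaryReal (goldenDigit b) ∈ XiG :=
  mem_XiG_iff.2 ⟨_, isGolden_goldenDigit b, by rw [goldenDigit], rfl⟩

lemma measurable_binaryReal : Measurable fun b => binaryReal (goldenDigit b) := by
  refine measurable_of_tendsto_metrizable
    (f := fun n b => ∑ k ∈ Finset.range n, digitVal (goldenDigit b) (k + 1) / 2 ^ (k + 1))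
    (fun n => Finset.measurable_sum _ fun k _ => (measurable_digitVal (k + 1)).div_const _) ?_
  rw [tendsto_pi_nhds]
  exact fun b => (hasSum_binaryReal _).tendsto_sum_nat

/-- A set of small diameter has small mass within a set of sequences of large surprisal. -/
lemma bitMeasure_preimage_le (h : ℕ → unitInterval) (h0 : ∀ k, 0 < (h k : ℝ))
    (h1 : ∀ k, (h k : ℝ) < 1) {n : ℕ} {B : ℝ} {E : Set (ℕ → Bool)}
    (hE : ∀ b ∈ E, B ≤ surprisal (fun k => h k) (goldenDigit b) n) {U : Set ℝ}
    (hU : Metric.ediam U ≤ ENNReal.ofReal (1 / 2 ^ n)) :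
    bitMeasure h ((fun b => binaryReal (goldenDigit b)) ⁻¹' U ∩ E) ≤
      ENNReal.ofReal (5 * Real.exp (-B)) := by
  rcases ((fun b => binaryReal (goldenDigit b)) ⁻¹' U ∩ E).eq_empty_or_nonempty with hem | ⟨b₀, hb₀⟩
  · rw [hem]
    simp
  set c₀ := wordCode (goldenDigit b₀) n with hc₀
  -- Points within `2^(-n)` of each other have word codes differing by at most `2`, so at most five
  -- cylinders meet `U`. Truncation of `c₀ - 2` at zero is harmless.
  have hsub : (fun b => binaryReal (goldenDigit b)) ⁻¹' U ∩ E ⊆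
      ⋃ c ∈ Finset.Icc (c₀ - 2) (c₀ + 2), {b | b ∈ E ∧ wordCode (goldenDigit b) n = c} := by
    intro b hb
    simp only [Set.mem_iUnion]
    refine ⟨wordCode (goldenDigit b) n, ?_, hb.2, rfl⟩
    have hd : |binaryReal (goldenDigit b) - binaryReal (goldenDigit b₀)| ≤ 1 / 2 ^ n := by
      have := (Metric.edist_le_ediam_of_mem (s := U) hb.1 hb₀.1).trans hU
      rw [edist_dist, ENNReal.ofReal_le_ofReal_iff (by positivity), Real.dist_eq] at this
      exact this
    have h2 := binaryReal_mem (goldenDigit b) n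
    have h3 := binaryReal_mem (goldenDigit b₀) n
    rw [abs_le] at hd
    have hpow : (0 : ℝ) < 2 ^ n := by positivity
    rw [← hc₀] at h3
    have h4 : (wordCode (goldenDigit b) n : ℝ) / 2 ^ n ≤ (c₀ + 2 : ℝ) / 2 ^ n := by
      have : (c₀ + 2 : ℝ) / 2 ^ n = (c₀ + 1 : ℝ) / 2 ^ n + 1 / 2 ^ n := by ring
      linarith
    have h5 : (c₀ : ℝ) / 2 ^ n ≤ (wordCode (goldenDigit b) n + 2 : ℝ) / 2 ^ n := by
      have : (wordCode (goldenDigit b) n + 2 : ℝ) / 2 ^ n =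
        (wordCode (goldenDigit b) n + 1 : ℝ) / 2 ^ n + 1 / 2 ^ n := by ring
      linarith
    rw [div_le_div_iff_of_pos_right hpow] at h4 h5
    have h4' : wordCode (goldenDigit b) n ≤ c₀ + 2 := by exact_mod_cast h4
    have h5' : c₀ ≤ wordCode (goldenDigit b) n + 2 := by exact_mod_cast h5
    rw [Finset.mem_Icc]
    omega
  have hone : ∀ c, bitMeasure h {b | b ∈ E ∧ wordCode (goldenDigit b) n = c} ≤
      ENNReal.ofReal (Real.exp (-B)) := by
    intro c
    rcases {b | b ∈ E ∧ wordCode (goldenDigit b) n = c}.eq_empty_or_nonempty with hem | ⟨b₁, hb₁⟩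
    · rw [hem]
      simp
    refine (measure_mono (t := {b | ∀ k ∈ Finset.Icc 1 n, goldenDigit b k = goldenDigit b₁ k})
      ?_).trans ?_
    · intro b hb
      exact wordCode_injective (hb.2.trans hb₁.2.symm)
    · rw [bitMeasure_prefix h h0 h1 (isGolden_goldenDigit b₁) (by rw [goldenDigit])]
      exact ENNReal.ofReal_le_ofReal (Real.exp_le_exp.2 (neg_le_neg (hE b₁ hb₁.1)))
  refine (measure_mono hsub).trans ((measure_biUnion_finset_le _ _).trans ?_)
  refine (Finset.sum_le_card_nsmul _ _ _ fun c _ => hone c).trans ?_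
  rw [nsmul_eq_mul, ENNReal.ofReal_mul (by norm_num)]
  gcongr
  rw [Nat.card_Icc, ← ENNReal.ofReal_natCast]
  apply ENNReal.ofReal_le_ofReal
  have : c₀ + 2 + 1 - (c₀ - 2) ≤ 5 := by omega
  exact_mod_cast this

/-- Mass distribution principle for the image of `bitMeasure h`. -/
lemma gaugeMeasure_ne_zero (h : ℕ → unitInterval) (h0 : ∀ k, 0 < (h k : ℝ))
    (h1 : ∀ k, (h k : ℝ) < 1) {B : ℕ → ℝ}
    (hB : ∀ᵐ b ∂(bitMeasure h), ∀ᶠ j : ℕ in atTop,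
      B j ≤ surprisal (fun k => h k) (goldenDigit b) (j ^ 2))
    (hBtop : Tendsto B atTop atTop) {φ : ℝ → ℝ}
    (hφ : ∀ J : ℕ, ∃ ε > 0, ∀ d : ℝ, 0 < d → d ≤ ε →
      ∃ j ≥ J, d ≤ 1 / 2 ^ (j ^ 2) ∧ 5 * Real.exp (-B j) ≤ φ d) :
    gaugeMeasure φ XiG ≠ 0 := by
  -- The almost sure eventual bound is made uniform: it holds from a single `J` on a set of nonzero
  -- mass.
  obtain ⟨J, hJ⟩ : ∃ J : ℕ, bitMeasure h {b | ∀ j ≥ J,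
      B j ≤ surprisal (fun k => h k) (goldenDigit b) (j ^ 2)} ≠ 0 := by
    by_contra! hall
    have hnull := measure_iUnion_null hall
    have huniv : bitMeasure h Set.univ = 0 := by
      refine measure_mono_null (fun b _ => ?_) (measure_union_null hnull (ae_iff.1 hB))
      by_cases hb : ∀ᶠ j : ℕ in atTop, B j ≤ surprisal (fun k => h k) (goldenDigit b) (j ^ 2)
      · obtain ⟨J, hJ⟩ := eventually_atTop.1 hb
        exact Or.inl (Set.mem_iUnion.2 ⟨J, hJ⟩)
      · exact Or.inr hb
    simp at huniv
  set E : Set (ℕ → Bool) := {b | ∀ j ≥ J,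
      B j ≤ surprisal (fun k => h k) (goldenDigit b) (j ^ 2)} with hE
  set X : (ℕ → Bool) → ℝ := fun b => binaryReal (goldenDigit b) with hX
  obtain ⟨ε, hε, hεd⟩ := hφ J
  have hle : ((bitMeasure h).restrict E).map X ≤ gaugeMeasure φ := by
    refine Measure.le_mkMetric _ _ (ENNReal.ofReal ε) (ENNReal.ofReal_pos.2 hε) fun s hs => ?_
    -- The closure has the same diameter and is measurable, so the restricted pushforward can be
    -- evaluated without measurability of `E`.
    rw [← Metric.ediam_closure s] at hs ⊢
    refine (measure_mono subset_closure).trans ?_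
    rw [Measure.map_apply measurable_binaryReal isClosed_closure.measurableSet,
      Measure.restrict_apply (measurable_binaryReal isClosed_closure.measurableSet)]
    set U := closure s with hU
    have hfin : Metric.ediam U ≠ ⊤ := ne_top_of_le_ne_top ENNReal.ofReal_ne_top hs
    -- Nothing is known about `φ 0`, so sets of diameter zero are shown to have no mass, using that
    -- `B` tends to infinity.
    rcases eq_or_ne (Metric.ediam U) 0 with hz | hz
    · refine le_trans (le_of_eq ?_) zero_le
      have hlim : Tendsto (fun j => ENNReal.ofReal (5 * Real.exp (-B j))) atTop (𝓝 0) := by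
        have := (Real.tendsto_exp_neg_atTop_nhds_zero.comp hBtop).const_mul 5
        rw [mul_zero] at this
        simpa using ENNReal.tendsto_ofReal this
      refine le_antisymm (ge_of_tendsto hlim ?_) zero_le
      filter_upwards [eventually_ge_atTop J] with j hj
      exact bitMeasure_preimage_le h h0 h1 (E := E) (fun b hb => hb j hj)
        (by rw [hz]; exact zero_le)
    · obtain ⟨j, hj, hdj, hφj⟩ := hεd (Metric.ediam U).toReal (ENNReal.toReal_pos hz hfin)
        (ENNReal.toReal_le_of_le_ofReal hε.le hs)
      refine (bitMeasure_preimage_le h h0 h1 (n := j ^ 2) (B := B j) (E := E) (fun b hb => hb j hj)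
        ?_).trans (ENNReal.ofReal_le_ofReal hφj)
      exact ENNReal.le_ofReal_iff_toReal_le hfin (by positivity) |>.2 hdj
  have hpos : ((bitMeasure h).restrict E).map X XiG ≠ 0 := by
    intro hzero
    have h2 := Measure.le_map_apply (μ := (bitMeasure h).restrict E)
      measurable_binaryReal.aemeasurable XiG
    rw [hzero, (Set.eq_univ_of_forall fun b => binaryReal_goldenDigit_mem b :
      (fun b => binaryReal (goldenDigit b)) ⁻¹' XiG = Set.univ), Measure.restrict_apply_univ] at h2
    exact hJ (le_antisymm h2 zero_le)
  exact fun hzero => hpos (le_antisymm ((hle XiG).trans hzero.le) zero_le)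

/-- The price of sampling along squares: up to `3j` extra digits before the next square, at `L`
each, and the factor five from overlapping cylinders. Half of the surprisal gain covers it. -/
lemma eventually_linear_le {κ L : ℝ} (hκ : 0 < κ) (hL : 0 < L) :
    ∀ᶠ j : ℕ in atTop, Real.log 5 + 3 * j * L ≤
      κ / 2 * (((j ^ 2 : ℕ) : ℝ) / ((Nat.log 2 (j ^ 2) : ℝ) + 7) ^ 2) := by
  have hlog5 : 0 < Real.log 5 := Real.log_pos (by norm_num)
  have hsqrt : Tendsto (fun j : ℕ => Real.sqrt j) atTop atTop :=
    Real.tendsto_sqrt_atTop.comp tendsto_natCast_atTop_atTop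
  filter_upwards [hsqrt.eventually_ge_atTop ((Real.log 5 + 3 * L) * 47 ^ 5 / (κ / 2)),
    eventually_ge_atTop 1] with j hj hj1
  have hj' : (1 : ℝ) ≤ j := by exact_mod_cast hj1
  rw [div_le_iff₀ (by positivity)] at hj
  have h1 := log_add_seven_pow_le (n := j ^ 2) (Nat.one_le_pow _ _ hj1)
  have h2 : (((j ^ 2 : ℕ) : ℝ)) ^ (1 / 4 : ℝ) = Real.sqrt j := by
    push_cast
    rw [Real.sqrt_eq_rpow, ← Real.rpow_natCast (j : ℝ) 2, ← Real.rpow_mul (by linarith)]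
    norm_num
  rw [h2] at h1
  have hl : (0 : ℝ) ≤ Nat.log 2 (j ^ 2) := Nat.cast_nonneg _
  push_cast
  generalize (Nat.log 2 (j ^ 2) : ℝ) = l at *
  have h3 : (l + 7) ^ 2 ≤ (l + 7) ^ 5 := pow_le_pow_right₀ (by linarith) (by norm_num)
  rw [← mul_div_assoc, le_div_iff₀ (by positivity)]
  have hs := Real.sq_sqrt (show (0 : ℝ) ≤ j by linarith)
  have hs0 := Real.sqrt_nonneg (j : ℝ)
  set u := Real.sqrt j
  calc (Real.log 5 + 3 * j * L) * (l + 7) ^ 2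
      ≤ ((Real.log 5 + 3 * L) * j) * (47 ^ 5 * u) := by
        gcongr
        · nlinarith
        · linarith
    _ = j * u * ((Real.log 5 + 3 * L) * 47 ^ 5) := by ring
    _ ≤ j * u * (u * (κ / 2)) := by gcongr
    _ = κ / 2 * (j * u ^ 2) := by ring
    _ = κ / 2 * (j : ℝ) ^ 2 := by rw [hs]; ring

lemma eventually_le_log_sq (N : ℕ) : ∀ᶠ j : ℕ in atTop, N ≤ Nat.log 2 (j ^ 2) := by
  filter_upwards [eventually_ge_atTop (2 ^ N)] with j hj
  refine Nat.le_log_of_pow_le one_lt_two (hj.trans ?_)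
  exact Nat.le_self_pow two_ne_zero j

lemma phiGauge_ge {κ L c : ℝ} (hκ : 0 < κ) (hL : 0 < L) (hc : c ≤ κ / 128) (J : ℕ) :
    ∃ ε > 0, ∀ d : ℝ, 0 < d → d ≤ ε → ∃ j ≥ J, d ≤ 1 / 2 ^ (j ^ 2) ∧
      5 * Real.exp (-(((j ^ 2 : ℕ) : ℝ) * L +
        κ * (((j ^ 2 : ℕ) : ℝ) / ((Nat.log 2 (j ^ 2) : ℝ) + 7) ^ 2))) ≤
      phiGauge (L / Real.log 2) c d := by
  obtain ⟨N, hN⟩ := eventually_atTop.1 ((eventually_linear_le hκ hL).and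
    ((eventually_le_log_sq 9).and (eventually_ge_atTop (J + 1))))
  have hlog2 : 0 < Real.log 2 := Real.log_pos one_lt_two
  refine ⟨1 / 2 ^ (N ^ 2), by positivity, fun d hd hdε => ?_⟩
  have hNJ := (hN N le_rfl).2.2
  set y : ℝ := -Real.log d / Real.log 2 with hy
  have hlogd : Real.log d = -(y * Real.log 2) := by rw [hy]; field_simp
  have hyN : (N : ℝ) ^ 2 ≤ y := by
    have := Real.log_le_log hd hdε
    rw [one_div, Real.log_inv, Real.log_pow] at this
    rw [hy, le_div_iff₀ hlog2]
    push_cast at this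
    linarith
  have hy0 : 0 ≤ y := (sq_nonneg _).trans hyN
  -- With `d = 2^(-y)`, this picks the largest square not exceeding `y`.
  set j := ⌊Real.sqrt y⌋₊ with hj
  have hjle : (j : ℝ) ≤ Real.sqrt y := Nat.floor_le (Real.sqrt_nonneg y)
  have hjlt : Real.sqrt y < j + 1 := Nat.lt_floor_add_one _
  have hNj : N ≤ j := by
    rw [hj]
    apply Nat.le_floor
    exact Real.le_sqrt_of_sq_le hyN
  have hj1 : (1 : ℝ) ≤ j := by exact_mod_cast (show 1 ≤ j by omega)
  have hsq := Real.sq_sqrt hy0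
  have hnle : (j : ℝ) ^ 2 ≤ y := by
    rw [← hsq]
    exact pow_le_pow_left₀ (by linarith) hjle 2
  have hnlt : y ≤ (j : ℝ) ^ 2 + 3 * j := by
    have : y ≤ ((j : ℝ) + 1) ^ 2 := by
      rw [← hsq]
      exact pow_le_pow_left₀ (Real.sqrt_nonneg y) hjlt.le 2
    nlinarith
  obtain ⟨hlin, hlog9, -⟩ := hN j hNj
  refine ⟨j, by omega, ?_, ?_⟩
  · rw [← Real.log_le_log_iff hd (by positivity), hlogd, one_div, Real.log_inv, Real.log_pow]
    push_cast
    nlinarith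
  have hpow : (2 : ℝ) ^ Nat.log 2 (j ^ 2) ≤ (j : ℝ) ^ 2 := by
    exact_mod_cast Nat.pow_log_le_self 2 (pow_ne_zero 2 (by omega : j ≠ 0))
  have hl9 : (9 : ℝ) ≤ Nat.log 2 (j ^ 2) := by exact_mod_cast hlog9
  have hhalf : (1 : ℝ) / 2 ≤ Real.log 2 := by linarith [Real.log_two_gt_d9]
  have hlog2le : Real.log 2 ≤ 1 := by linarith [Real.log_two_lt_d9]
  have hloglog : ((Nat.log 2 (j ^ 2) : ℝ) + 7) / 4 ≤ Real.log (y * Real.log 2) := by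
    have h1 : (2 : ℝ) ^ Nat.log 2 (j ^ 2) / 2 ≤ y * Real.log 2 := by nlinarith
    have h2 := Real.log_le_log (by positivity) h1
    rw [Real.log_div (by positivity) two_ne_zero, Real.log_pow] at h2
    nlinarith
  push_cast at hlin ⊢
  generalize (Nat.log 2 (j ^ 2) : ℝ) = l at *
  set n : ℝ := (j : ℝ) ^ 2 with hn
  have habs : |Real.log d| = y * Real.log 2 := by
    rw [hlogd, abs_neg, abs_of_nonneg (by positivity)]
  have hds : d ^ (L / Real.log 2) = Real.exp (-(y * L)) := by
    rw [Real.rpow_def_of_pos hd, hlogd]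
    congr 1
    field_simp
  rw [phiGauge, habs, hds, ← Real.exp_add]
  nth_rw 1 [← Real.exp_log (show (0 : ℝ) < 5 by norm_num)]
  rw [← Real.exp_add, Real.exp_le_exp]
  -- The `64` is `4 * 4^2`, from `|log d| ≤ 4n` and `log |log d| ≥ (l + 7) / 4`; with `c ≤ κ / 128`
  -- the gauge uses at most the other half of the gain.
  have hquot : y * Real.log 2 / Real.log (y * Real.log 2) ^ 2 ≤ 64 * (n / (l + 7) ^ 2) := by
    have h1 : ((l + 7) / 4) ^ 2 ≤ Real.log (y * Real.log 2) ^ 2 :=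
      pow_le_pow_left₀ (by linarith) hloglog 2
    have h2 : y * Real.log 2 ≤ 4 * n := by nlinarith
    calc _ ≤ 4 * n / ((l + 7) / 4) ^ 2 := by gcongr
      _ = _ := by field_simp; ring
  have h3 := mul_le_mul hc hquot (by positivity) (by positivity)
  nlinarith

/-- The slowly perturbed gauges give the golden mean set positive measure. -/
lemma exists_phiGauge_ne_zero {p : ℝ} (hp0 : 0 < p) (hp1 : p < 1) (hp : p ^ 3 = (1 - p) ^ 2) :
    ∃ c₀ : ℝ, 0 < c₀ ∧ ∀ c : ℝ, 0 ≤ c → c < c₀ →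
      gaugeMeasure (phiGauge (-Real.logb 2 p) c) XiG ≠ 0 := by
  obtain ⟨h, κ, hκ, h0, h1, hae⟩ := exists_bias_ae hp0 hp1 hp
  have hL : 0 < -Real.log p := neg_pos.2 (Real.log_neg hp0 hp1)
  refine ⟨κ / 128, by positivity, fun c hc0 hc => gaugeMeasure_ne_zero h h0 h1 hae ?_ fun J => ?_⟩
  · have h2 : Tendsto (fun j : ℕ => (j : ℝ) * (-Real.log p)) atTop atTop :=
      tendsto_natCast_atTop_atTop.atTop_mul_const hL
    refine tendsto_atTop_mono (fun j => ?_) h2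
    have h3 : (j : ℝ) ≤ ((j ^ 2 : ℕ) : ℝ) := by exact_mod_cast Nat.le_self_pow two_ne_zero j
    have h4 : 0 ≤ κ * (((j ^ 2 : ℕ) : ℝ) / ((Nat.log 2 (j ^ 2) : ℝ) + 7) ^ 2) := by positivity
    nlinarith
  · have h5 : -Real.logb 2 p = -Real.log p / Real.log 2 := by rw [Real.logb, neg_div]
    rw [h5]
    exact phiGauge_ge hκ hL hc.le J

/-! ### Comparison of gauges, σ-finiteness and dimension -/

/-- If the gauge `φ` is negligible with respect to `χ`, sets that are σ-finite for `χ` are null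
for `φ`. -/
lemma not_sigmaFinite_of_ne_zero {m₁ m₂ : ℝ≥0∞ → ℝ≥0∞} {A : Set ℝ}
    (hm : ∀ k : ℕ, ∀ᶠ d in 𝓝[≥] (0 : ℝ≥0∞), m₁ d ≤ (((k : ℝ≥0∞) + 1)⁻¹ • m₂) d)
    (hne : (Measure.mkMetric m₁ : Measure ℝ) A ≠ 0) :
    ¬ SigmaFinite ((Measure.mkMetric m₂ : Measure ℝ).restrict A) := by
  intro hσ
  apply hne
  have hnull : ∀ i, (Measure.mkMetric m₁ : Measure ℝ)
      (spanningSets ((Measure.mkMetric m₂ : Measure ℝ).restrict A) i ∩ A) = 0 := by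
    intro i
    have hfin := measure_spanningSets_lt_top ((Measure.mkMetric m₂ : Measure ℝ).restrict A) i
    rw [Measure.restrict_apply (measurableSet_spanningSets _ i)] at hfin
    set T := spanningSets ((Measure.mkMetric m₂ : Measure ℝ).restrict A) i ∩ A
    have hle : ∀ k : ℕ, (Measure.mkMetric m₁ : Measure ℝ) T ≤
        ((k : ℝ≥0∞) + 1)⁻¹ * (Measure.mkMetric m₂ : Measure ℝ) T := fun k =>
      Measure.mkMetric_mono_smul (X := ℝ) (by simp) (by simp) (hm k) T
    have hlim : Tendsto (fun k : ℕ => ((k : ℝ≥0∞) + 1)⁻¹ * (Measure.mkMetric m₂ : Measure ℝ) T)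
        atTop (𝓝 0) := by
      have h1 : Tendsto (fun k : ℕ => ((k : ℝ≥0∞) + 1)⁻¹) atTop (𝓝 0) := by
        have := (tendsto_add_atTop_iff_nat 1).2 ENNReal.tendsto_inv_nat_nhds_zero
        simpa using this
      have := ENNReal.Tendsto.mul_const h1 (b := (Measure.mkMetric m₂ : Measure ℝ) T)
        (Or.inr hfin.ne)
      rwa [zero_mul] at this
    exact le_antisymm (ge_of_tendsto' hlim hle) zero_le
  have hcover : A ⊆ ⋃ i, spanningSets ((Measure.mkMetric m₂ : Measure ℝ).restrict A) i ∩ A := by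
    rw [← Set.iUnion_inter, iUnion_spanningSets, Set.univ_inter]
  exact measure_mono_null hcover (measure_iUnion_null hnull)

lemma eventually_toReal_of_nhdsGT {P : ℝ → Prop} (h0 : P 0) (h : ∀ᶠ t in 𝓝[>] (0 : ℝ), P t) :
    ∀ᶠ d in 𝓝 (0 : ℝ≥0∞), P d.toReal := by
  have h1 : ∀ᶠ t in 𝓝[≥] (0 : ℝ), P t := by
    rw [← Set.Ioi_insert, nhdsWithin_insert, eventually_sup]
    exact ⟨by simpa using h0, h⟩
  have h2 : Tendsto ENNReal.toReal (𝓝 0) (𝓝[≥] (0 : ℝ)) :=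
    tendsto_nhdsWithin_of_tendsto_nhds_of_eventually_within _
      (by simpa using ENNReal.tendsto_toReal ENNReal.zero_ne_top)
      (Eventually.of_forall fun d => ENNReal.toReal_nonneg)
  exact h2.eventually h1

lemma tendsto_abs_log_nhdsGT : Tendsto (fun t : ℝ => |Real.log t|) (𝓝[>] 0) atTop :=
  tendsto_abs_atBot_atTop.comp Real.tendsto_log_nhdsGT_zero

lemma phiGauge_zero_right {s : ℝ} (hs : s ≠ 0) (c : ℝ) : phiGauge s c 0 = 0 := by
  rw [phiGauge, Real.zero_rpow hs, zero_mul]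

lemma tendsto_div_log_sq_atTop : Tendsto (fun u : ℝ => u / Real.log u ^ 2) atTop atTop := by
  have h1 : Tendsto (fun u : ℝ => Real.log u ^ 2 / u) atTop (𝓝 0) :=
    (Real.isLittleO_pow_log_id_atTop (n := 2)).tendsto_div_nhds_zero
  have h2 : Tendsto (fun u : ℝ => Real.log u ^ 2 / u) atTop (𝓝[>] 0) := by
    refine tendsto_nhdsWithin_of_tendsto_nhds_of_eventually_within _ h1 ?_
    filter_upwards [eventually_gt_atTop 1] with u hu
    have := Real.log_pos hu
    have hu0 : 0 < u := by linarith
    exact Set.mem_Ioi.2 (by positivity)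
  refine (h2.inv_tendsto_nhdsGT_zero).congr fun u => ?_
  simp

/-- Increasing the constant makes the gauge smaller by an arbitrarily large factor. -/
lemma eventually_phiGauge_le {s c c' : ℝ} (hs : s ≠ 0) (hcc : c < c') {M : ℝ} (hM : 0 < M) :
    ∀ᶠ d in 𝓝 (0 : ℝ≥0∞), phiGauge s c' d.toReal ≤ M * phiGauge s c d.toReal := by
  refine eventually_toReal_of_nhdsGT (P := fun t => phiGauge s c' t ≤ M * phiGauge s c t) ?_ ?_
  · rw [phiGauge_zero_right hs, phiGauge_zero_right hs, mul_zero]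
  have h1 := (tendsto_div_log_sq_atTop.comp tendsto_abs_log_nhdsGT).eventually_ge_atTop
    (-Real.log M / (c' - c))
  filter_upwards [h1, self_mem_nhdsWithin] with t ht ht0
  rw [Function.comp_apply, div_le_iff₀ (by linarith)] at ht
  have hts : 0 < t ^ s := Real.rpow_pos_of_pos ht0 s
  rw [phiGauge, phiGauge]
  nth_rw 1 [← Real.exp_log hM]
  rw [mul_left_comm, ← Real.exp_add]
  gcongr
  linarith

lemma eventually_rpow_eq (s : ℝ) (hs : 0 < s) :
    ∀ᶠ d in 𝓝 (0 : ℝ≥0∞), d ^ s = ENNReal.ofReal (phiGauge s 0 d.toReal) := by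
  filter_upwards [gt_mem_nhds (show (0 : ℝ≥0∞) < ⊤ from ENNReal.zero_lt_top)] with d hd
  rw [phiGauge, neg_zero, zero_mul, Real.exp_zero, mul_one,
    ← ENNReal.ofReal_rpow_of_nonneg ENNReal.toReal_nonneg hs.le, ENNReal.ofReal_toReal hd.ne]

lemma hausdorffMeasure_eq_gaugeMeasure {s : ℝ} (hs : 0 < s) :
    (Measure.hausdorffMeasure s : Measure ℝ) = gaugeMeasure (phiGauge s 0) :=
  le_antisymm (Measure.mkMetric_mono ((eventually_rpow_eq s hs).mono fun _ h => h.le))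
    (Measure.mkMetric_mono ((eventually_rpow_eq s hs).mono fun _ h => h.ge))

lemma not_sigmaFinite_phiGauge {s c c' : ℝ} (hs : 0 < s) (hcc : c < c')
    (hne : gaugeMeasure (phiGauge s c') XiG ≠ 0) :
    ¬ SigmaFinite ((gaugeMeasure (phiGauge s c)).restrict XiG) := by
  refine not_sigmaFinite_of_ne_zero (fun k => nhdsWithin_le_nhds ?_) hne
  filter_upwards [eventually_phiGauge_le hs.ne' hcc
    (show (0 : ℝ) < ((k : ℝ) + 1)⁻¹ by positivity)] with d hd
  refine (ENNReal.ofReal_le_ofReal hd).trans (le_of_eq ?_)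
  rw [ENNReal.ofReal_mul (by positivity), ENNReal.ofReal_inv_of_pos (by positivity),
    ENNReal.ofReal_add (by positivity) zero_le_one, ENNReal.ofReal_natCast, ENNReal.ofReal_one]
  rfl

lemma measure_eq_top_of_not_sigmaFinite {α : Type*} [MeasurableSpace α] {μ : Measure α} {A : Set α}
    (h : ¬ SigmaFinite (μ.restrict A)) : μ A = ⊤ := by
  by_contra hA
  apply h
  have : IsFiniteMeasure (μ.restrict A) := ⟨by
    rw [Measure.restrict_apply_univ]
    exact lt_top_iff_ne_top.2 hA⟩
  infer_instance

/-- The factor `r^(d - s) = exp (-(d - s) |log r|)` decays faster than `exp (-|log r| / log |log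
r|)`. Hence nullity for the gauge with `θ = 1` already bounds the dimension by `s`. -/
lemma rpow_le_psiGauge {s d : ℝ} (hs : 0 < s) (hd : s < d) :
    ∀ᶠ r in 𝓝 (0 : ℝ≥0∞), r ^ d ≤ ENNReal.ofReal (psiGauge s 1 r.toReal) := by
  have hreal : ∀ᶠ r in 𝓝 (0 : ℝ≥0∞), phiGauge d 0 r.toReal ≤ psiGauge s 1 r.toReal := by
    refine eventually_toReal_of_nhdsGT (P := fun t => phiGauge d 0 t ≤ psiGauge s 1 t) ?_ ?_
    · rw [phiGauge_zero_right (by linarith), psiGauge, Real.zero_rpow hs.ne', zero_mul]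
    have h1 := (Real.tendsto_log_atTop.comp tendsto_abs_log_nhdsGT).eventually_ge_atTop
      (1 / (d - s))
    filter_upwards [h1, Ioo_mem_nhdsGT (show (0 : ℝ) < 1 by norm_num)] with t ht ht0
    rw [Function.comp_apply, div_le_iff₀ (by linarith)] at ht
    have hlog : 0 < Real.log |Real.log t| := by
      by_contra! hneg
      nlinarith
    rw [phiGauge, psiGauge, Real.rpow_one, neg_zero, zero_mul, Real.exp_zero, mul_one,
      Real.rpow_def_of_pos ht0.1, Real.rpow_def_of_pos ht0.1, ← Real.exp_add, Real.exp_le_exp]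
    have hneg := Real.log_neg ht0.1 ht0.2
    have h2 : |Real.log t| / Real.log |Real.log t| ≤ |Real.log t| * (d - s) := by
      rw [div_le_iff₀ hlog]
      nlinarith [abs_nonneg (Real.log t)]
    rw [abs_of_neg hneg] at h2 ⊢
    linarith
  filter_upwards [hreal, eventually_rpow_eq d (by linarith)] with r h1 h2
  rw [h2]
  exact ENNReal.ofReal_le_ofReal h1

lemma dimH_XiG_eq {s : ℝ} (hs : 0 < s) (hlow : (Measure.hausdorffMeasure s : Measure ℝ) XiG ≠ 0)
    (hup : gaugeMeasure (psiGauge s 1) XiG = 0) : dimH XiG = ENNReal.ofReal s := by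
  apply le_antisymm
  · refine dimH_le fun d hd => ?_
    by_contra! hlt
    have hsd : s < d := by
      rw [ENNReal.ofReal, ENNReal.coe_lt_coe] at hlt
      rw [← Real.coe_toNNReal s hs.le]
      exact_mod_cast hlt
    have h1 : (Measure.hausdorffMeasure (d : ℝ) : Measure ℝ) ≤ gaugeMeasure (psiGauge s 1) :=
      Measure.mkMetric_mono (rpow_le_psiGauge hs hsd)
    have h2 := h1 XiG
    rw [hd, hup] at h2
    exact absurd h2 (by simp)
  · refine le_dimH_of_hausdorffMeasure_ne_zero (d := s.toNNReal) ?_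
    rwa [Real.coe_toNNReal s hs.le]

/-! ### Upper bound: every sequence is often well predicted -/

lemma not_bddBelow_of_harmonic_decrease {f : ℕ → ℝ} {c M : ℝ} (hc : 0 < c) {m₀ : ℕ}
    (hf : ∀ m ≥ m₀, c / ((m : ℝ) + 1) ≤ f m - f (m + 1)) (hM : ∀ m ≥ m₀, -M ≤ f m) : False := by
  have hsum : ∀ k : ℕ, c * (∑ i ∈ Finset.range (m₀ + k), 1 / ((i : ℝ) + 1) -
      ∑ i ∈ Finset.range m₀, 1 / ((i : ℝ) + 1)) ≤ f m₀ - f (m₀ + k) := by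
    intro k
    induction k with
    | zero => simp
    | succ k ih =>
      rw [← add_assoc, Finset.sum_range_succ]
      have := hf (m₀ + k) (by omega)
      rw [← mul_one_div] at this
      linarith
  have hlim : Tendsto (fun k : ℕ => c * (∑ i ∈ Finset.range (k + m₀), 1 / ((i : ℝ) + 1) -
      ∑ i ∈ Finset.range m₀, 1 / ((i : ℝ) + 1))) atTop atTop :=
    (tendsto_atTop_add_const_right _ _ ((tendsto_add_atTop_iff_nat m₀).2
      Real.tendsto_sum_range_one_div_nat_succ_atTop)).const_mul_atTop hc
  obtain ⟨k, hk⟩ := (hlim.eventually_gt_atTop (f m₀ + M)).exists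
  have h1 := hsum k
  have h2 := hM (m₀ + k) (by omega)
  rw [add_comm k] at hk
  linarith

/-- A bounded sequence cannot decrease forever at the rate `1 / m ^ 2 + 2 |β m| / m`. -/
lemma no_riccati_decrease {β : ℕ → ℝ} {M : ℝ} {m₀ : ℕ} (hM : ∀ m, -M ≤ β m)
    (hβ : ∀ m ≥ m₀, 1 / ((m : ℝ) + 1) ^ 2 + 2 * |β (m + 1)| / ((m : ℝ) + 1) ≤ β m - β (m + 1)) :
    False := by
  -- If `β` stayed nonnegative, `m * β m` would too. But the coefficient `2` gives `2m / (m + 1) ≥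
  -- 1`, and the term `1 / (m + 1)^2` then makes `m * β m` drop by at least `1 / (2(m + 1))`, a
  -- divergent total.
  have hneg : ∃ m ≥ m₀, β m < 0 := by
    by_contra! hpos
    refine not_bddBelow_of_harmonic_decrease (f := fun m : ℕ => (m : ℝ) * β m) (c := 1 / 2) (M := 0)
      (by norm_num) (m₀ := max m₀ 1) (fun m hm => ?_) (fun m hm => ?_)
    · have hm0 : m₀ ≤ m := (le_max_left _ _).trans hm
      have hm1 : (1 : ℝ) ≤ m := by exact_mod_cast (le_max_right _ _).trans hm
      have h1 := hβ m hm0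
      have h2 := hpos (m + 1) (by omega)
      rw [abs_of_nonneg h2] at h1
      push_cast
      have h3 := mul_le_mul_of_nonneg_left h1 (show (0 : ℝ) ≤ m by linarith)
      have h4 : (m : ℝ) * (1 / ((m : ℝ) + 1) ^ 2 + 2 * β (m + 1) / ((m : ℝ) + 1)) =
          (m / ((m : ℝ) + 1)) * (1 / ((m : ℝ) + 1)) + 2 * (m / ((m : ℝ) + 1)) * β (m + 1) := by
        field_simp
      have h5 : 1 / 2 ≤ (m : ℝ) / (m + 1) := by
        rw [div_le_div_iff₀ (by norm_num) (by linarith)]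
        linarith
      have h6 : 0 < 1 / ((m : ℝ) + 1) := by positivity
      rw [h4] at h3
      have h7 : 1 / 2 / ((m : ℝ) + 1) = 1 / 2 * (1 / ((m : ℝ) + 1)) := by ring
      rw [h7]
      nlinarith
    · have := hpos m ((le_max_left _ _).trans hm)
      rw [neg_zero]
      positivity
  obtain ⟨m₁, hm₁, hlt⟩ := hneg
  -- Once negative, `β` stays bounded away from zero, so the term `2|β| / m` alone drives it to
  -- minus infinity.
  have hmono : ∀ m ≥ m₁, β m ≤ β m₁ := by
    intro m hm
    induction m, hm using Nat.le_induction with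
    | base => exact le_rfl
    | succ m hm ih =>
      have h1 := hβ m (by omega)
      have h2 : 0 ≤ 1 / ((m : ℝ) + 1) ^ 2 + 2 * |β (m + 1)| / ((m : ℝ) + 1) := by positivity
      linarith
  refine not_bddBelow_of_harmonic_decrease (f := β) (c := 2 * (-β m₁)) (by linarith) (m₀ := m₁)
    (fun m hm => ?_) (fun m _ => hM m)
  have h1 := hβ m (by omega)
  have h2 := hmono (m + 1) (by omega)
  have h3 : -β m₁ ≤ |β (m + 1)| := by
    rw [abs_of_neg (by linarith)]
    linarith
  have h4 : 2 * (-β m₁) / ((m : ℝ) + 1) ≤ 2 * |β (m + 1)| / ((m : ℝ) + 1) := by gcongr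
  have h5 : 0 ≤ 1 / ((m : ℝ) + 1) ^ 2 := by positivity
  linarith

/-- The density of ones among the first `2 ^ l` digits. -/
noncomputable def dyadicDensity (a : ℕ → Bool) (l : ℕ) : ℝ :=
  (∑ k ∈ Finset.Icc 1 (2 ^ l), digitVal a k) / 2 ^ l

lemma dyadicDensity_mem (a : ℕ → Bool) (l : ℕ) :
    0 ≤ dyadicDensity a l ∧ dyadicDensity a l ≤ 1 := by
  unfold dyadicDensity
  refine ⟨div_nonneg (Finset.sum_nonneg fun k _ => digitVal_nonneg _ _) (by positivity), ?_⟩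
  rw [div_le_one (by positivity)]
  refine (Finset.sum_le_card_nsmul _ _ 1 fun k _ => digitVal_le_one a k).trans (le_of_eq ?_)
  simp

lemma surprisal_const_two_pow (t : ℝ) {a : ℕ → Bool} (ha : IsGolden a) (l : ℕ) :
    surprisal (fun _ => t) a (2 ^ (l + 1)) = 2 ^ (l + 1) *
      (-Real.log (1 - t) * (1 - dyadicDensity a (l + 1) - dyadicDensity a l / 2) -
        Real.log t * dyadicDensity a (l + 1)) := by
  rw [surprisal_eq _ ha, ← Finset.mul_sum, ← Finset.mul_sum,
    show 2 ^ (l + 1) / 2 = 2 ^ l by rw [pow_succ]; omega]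
  unfold dyadicDensity
  simp only [Finset.sum_const, Nat.card_Icc, Nat.add_sub_cancel, nsmul_eq_mul]
  push_cast
  have h2 : (2 : ℝ) ^ (l + 1) = 2 * 2 ^ l := by ring
  rw [h2]
  field_simp
  ring

lemma abs_log_add_sub_le {x δ : ℝ} (hx : 0 < x) (hδ : |δ| ≤ x / 2) :
    |-Real.log (x + δ) + Real.log x + δ / x| ≤ 2 * δ ^ 2 / x ^ 2 := by
  have hb := abs_le.1 hδ
  have hxd : 0 < x + δ := by linarith
  have hz : (x + δ) / x = 1 + δ / x := by field_simp
  have h1 := Real.log_le_sub_one_of_pos (div_pos hxd hx)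
  have h2 := Real.one_sub_inv_le_log_of_pos (div_pos hxd hx)
  rw [Real.log_div hxd.ne' hx.ne'] at h1 h2
  have h3 : δ / x - 2 * δ ^ 2 / x ^ 2 ≤ 1 - ((x + δ) / x)⁻¹ := by
    have h4 : 1 - ((x + δ) / x)⁻¹ - δ / x = -(δ ^ 2 / (x * (x + δ))) := by
      field_simp
      ring
    have h5 : δ ^ 2 / (x * (x + δ)) ≤ δ ^ 2 / (x * (x / 2)) := by
      gcongr
      linarith
    have h6 : δ ^ 2 / (x * (x / 2)) = 2 * δ ^ 2 / x ^ 2 := by field_simp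
    linarith
  rw [hz] at h1
  rw [abs_le]
  have h7 : 0 ≤ 2 * δ ^ 2 / x ^ 2 := by positivity
  constructor <;> linarith

/-- Second order expansion of the surprisal rate of a homogeneous bias near the stationary one. -/
lemma rate_le {p δ α α' : ℝ} (hp0 : 0 < p) (hp1 : p < 1)
    (hlog : Real.log (1 - p) = 3 / 2 * Real.log p) (hα : 0 ≤ α ∧ α ≤ 1) (hα' : 0 ≤ α' ∧ α' ≤ 1)
    (hδp : |δ| ≤ p / 2) (hδq : |δ| ≤ (1 - p) / 2) :
    -Real.log (1 - (1 - p - δ)) * (1 - α' - α / 2) - Real.log (1 - p - δ) * α' ≤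
      -Real.log p + -Real.log p / 2 * (α' - α) +
      δ * ((3 / (2 * p) + 1 / (1 - p)) * α' - 1 / p - (α' - α) / (2 * p)) +
      (2 / p ^ 2 + 2 / (1 - p) ^ 2) * δ ^ 2 := by
  have h1 := abs_le.1 (abs_log_add_sub_le hp0 hδp)
  have h2 := abs_le.1 (abs_log_add_sub_le (δ := -δ) (sub_pos.2 hp1) (by rwa [abs_neg]))
  rw [show 1 - (1 - p - δ) = p + δ by ring, show 1 - p - δ = 1 - p + -δ by ring]
  set u := -Real.log (p + δ) + Real.log p + δ / p with hu
  set v := -Real.log (1 - p + -δ) + Real.log (1 - p) + -δ / (1 - p) with hv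
  have h3 : -Real.log (p + δ) * (1 - α' - α / 2) - Real.log (1 - p + -δ) * α' =
      (u - Real.log p - δ / p) * (1 - α' - α / 2) +
        (v - 3 / 2 * Real.log p + δ / (1 - p)) * α' := by
    rw [hu, hv, hlog]
    ring
  have h4 : u * (1 - α' - α / 2) ≤ 2 * δ ^ 2 / p ^ 2 := by
    have h5 : |u * (1 - α' - α / 2)| ≤ 2 * δ ^ 2 / p ^ 2 * 1 := by
      rw [abs_mul]
      exact mul_le_mul (abs_le.2 h1) (abs_le.2 ⟨by linarith, by linarith⟩) (abs_nonneg _)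
        (by positivity)
    rw [mul_one] at h5
    exact (le_abs_self _).trans h5
  have h5 : v * α' ≤ 2 * δ ^ 2 / (1 - p) ^ 2 := by
    have h6 := mul_le_mul_of_nonneg_right h2.2 hα'.1
    rw [neg_sq] at h6
    have h7 : 0 ≤ 2 * δ ^ 2 / (1 - p) ^ 2 := by positivity
    nlinarith
  have h8 : (-Real.log p - δ / p) * (1 - α' - α / 2) +
        (-(3 / 2 * Real.log p) + δ / (1 - p)) * α' =
      -Real.log p + -Real.log p / 2 * (α' - α) +
      δ * ((3 / (2 * p) + 1 / (1 - p)) * α' - 1 / p - (α' - α) / (2 * p)) := by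
    have hq : 1 - p ≠ 0 := by linarith
    field_simp
    ring
  have h9 : (2 / p ^ 2 + 2 / (1 - p) ^ 2) * δ ^ 2 = 2 * δ ^ 2 / p ^ 2 + 2 * δ ^ 2 / (1 - p) ^ 2 := by
    ring
  rw [h3, h9]
  linarith

/-- Every golden sequence is infinitely often well predicted by one of two nearly stationary
biases. -/
lemma exists_frequently_surprisal_le {p : ℝ} (hp0 : 0 < p) (hp1 : p < 1)
    (hp : p ^ 3 = (1 - p) ^ 2) :
    ∃ K C : ℝ, 0 < K ∧ 0 < C ∧ ∀ a, IsGolden a → ∀ m₀ : ℕ, ∃ m ≥ m₀, ∃ σ : ℝ, |σ| = 1 ∧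
      surprisal (fun _ => 1 - p - σ * (K / m)) a (2 ^ m) ≤
        2 ^ m * (-Real.log p + C / (m : ℝ) ^ 2) := by
  have hlog := log_one_sub_of_cube_eq hp
  have hL : 0 < -Real.log p := neg_pos.2 (Real.log_neg hp0 hp1)
  have hq0 : 0 < 1 - p := by linarith
  obtain ⟨L, hLdef⟩ : ∃ L, L = -Real.log p := ⟨_, rfl⟩
  rw [← hLdef] at hL
  obtain ⟨κ, hκdef⟩ : ∃ κ, κ = 3 / (2 * p) + 1 / (1 - p) := ⟨_, rfl⟩
  have hκ : 0 < κ := by rw [hκdef]; positivity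
  obtain ⟨D, hD⟩ : ∃ D, D = 2 / p ^ 2 + 2 / (1 - p) ^ 2 := ⟨_, rfl⟩
  have hD0 : 0 < D := by rw [hD]; positivity
  -- Tuned so that the first-order term `(K / m) κ |β|` equals `2 L |β| / m`, the coefficient
  -- `no_riccati_decrease` needs after division by `L`.
  obtain ⟨K, hK⟩ : ∃ K, K = 2 * L / κ := ⟨_, rfl⟩
  have hK0 : 0 < K := by rw [hK]; positivity
  have hKκ : K * κ = 2 * L := by rw [hK]; field_simp
  -- `D * K ^ 2` absorbs the second-order error of the expansion; the remaining `L` supplies the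
  -- term `1 / m^2`.
  refine ⟨K, D * K ^ 2 + L, hK0, by positivity, fun a ha m₀ => ?_⟩
  by_contra! hbad
  obtain ⟨N, hN⟩ : ∃ N : ℕ, ∀ m ≥ N, K / ((m : ℝ) + 1) ≤ min (min (p / 2) ((1 - p) / 2)) (L * p) := by
    have h1 : Tendsto (fun m : ℕ => K / ((m : ℝ) + 1)) atTop (𝓝 0) :=
      tendsto_const_nhds.div_atTop
        (tendsto_atTop_add_const_right _ _ tendsto_natCast_atTop_atTop)
    exact eventually_atTop.1 (h1.eventually (ge_mem_nhds (by positivity)))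
  -- The centre `1 / (p * κ) = 2(1 - p) / (3 - p)` is the stationary density of ones.
  refine no_riccati_decrease (β := fun m => 1 / (p * κ) - dyadicDensity a m) (M := 1)
    (m₀ := max m₀ N) (fun m => ?_) (fun m hm => ?_)
  · have h1 := (dyadicDensity_mem a m).2
    have h2 : 0 ≤ 1 / (p * κ) := by positivity
    linarith
  have hm0 : m₀ ≤ m := (le_max_left _ _).trans hm
  have hδ := hN m ((le_max_right _ _).trans hm)
  rw [le_min_iff, le_min_iff] at hδ
  obtain ⟨x, hx⟩ : ∃ x : ℝ, x = (m : ℝ) + 1 := ⟨_, rfl⟩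
  have hx0 : 0 < x := by rw [hx]; positivity
  rw [← hx] at hδ ⊢
  obtain ⟨α', hα'⟩ : ∃ y, y = dyadicDensity a (m + 1) := ⟨_, rfl⟩
  obtain ⟨α, hα⟩ : ∃ y, y = dyadicDensity a m := ⟨_, rfl⟩
  have hmem := dyadicDensity_mem a m
  have hmem' := dyadicDensity_mem a (m + 1)
  have hineq : ∀ σ : ℝ, |σ| = 1 → L / x ^ 2 + σ * (K / x) * (κ * (1 / (p * κ) - α')) <
      (L / 2 - σ * (K / x) / (2 * p)) * (α' - α) := by
    intro σ hσ
    have h1 := hbad (m + 1) (by omega) σ hσ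
    rw [surprisal_const_two_pow _ ha] at h1
    have habs : |σ * (K / x)| = K / x := by
      rw [abs_mul, hσ, one_mul, abs_of_pos (by positivity)]
    have h2 := rate_le hp0 hp1 hlog hmem hmem' (δ := σ * (K / x)) (by rw [habs]; exact hδ.1.1)
      (by rw [habs]; exact hδ.1.2)
    push_cast at h1
    rw [← hx] at h1
    have h3 := (lt_of_mul_lt_mul_left h1 (by positivity)).trans_le h2
    rw [← hκdef, ← hD, ← hLdef, ← hα, ← hα'] at h3
    have h4 : (σ * (K / x)) ^ 2 = K ^ 2 / x ^ 2 := by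
      rw [mul_pow, ← sq_abs σ, hσ, div_pow]
      ring
    have h5 : (D * K ^ 2 + L) / x ^ 2 = D * (K ^ 2 / x ^ 2) + L / x ^ 2 := by ring
    have h6 : κ * (1 / (p * κ) - α') = 1 / p - κ * α' := by field_simp
    rw [h4, h5] at h3
    rw [h6]
    have h7 : (L / 2 - σ * (K / x) / (2 * p)) * (α' - α) =
      L / 2 * (α' - α) - σ * (K / x) * ((α' - α) / (2 * p)) := by ring
    rw [h7]
    linarith
  rw [← hα, ← hα']
  -- Failure holds for both signs; the sign of the deviation turns the linear term into an absolute
  -- value.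
  obtain ⟨σ, hσ, hσβ⟩ : ∃ σ : ℝ, |σ| = 1 ∧ σ * (1 / (p * κ) - α') = |1 / (p * κ) - α'| := by
    rcases le_total 0 (1 / (p * κ) - α') with h | h
    · exact ⟨1, by norm_num, by rw [abs_of_nonneg h, one_mul]⟩
    · exact ⟨-1, by norm_num, by rw [abs_of_nonpos h]; ring⟩
  have h1 := hineq σ hσ
  have h2 : σ * (K / x) * (κ * (1 / (p * κ) - α')) = 2 * L / x * |1 / (p * κ) - α'| := by
    rw [← hσβ, ← hKκ]
    ring
  rw [h2] at h1
  have h3 : |σ * (K / x) / (2 * p)| ≤ L / 2 := by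
    rw [abs_div, abs_mul, hσ, one_mul, abs_of_pos (show 0 < K / x by positivity),
      abs_of_pos (show 0 < 2 * p by positivity), div_le_iff₀ (by positivity)]
    linarith [hδ.2]
  have h4 := abs_le.1 h3
  have h5 : 0 < L / x ^ 2 := by positivity
  have h6 : 0 ≤ 2 * L / x * |1 / (p * κ) - α'| := by positivity
  have h7 : 0 < α' - α := by
    by_contra! hneg
    nlinarith
  have h8 : L * (1 / x ^ 2 + 2 * |1 / (p * κ) - α'| / x) ≤ L * (α' - α) := by
    have : L * (1 / x ^ 2 + 2 * |1 / (p * κ) - α'| / x) =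
      L / x ^ 2 + 2 * L / x * |1 / (p * κ) - α'| := by ring
    rw [this]
    nlinarith
  have h9 := le_of_mul_le_mul_left h8 hL
  linarith

/-! ### Counting well predicted words and covering by dyadic intervals -/

/-- Few words have small surprisal. -/
lemma card_le_exp_of_surprisal_le {t B : ℝ} (ht0 : 0 < t) (ht1 : t < 1) {n : ℕ} {T : Finset ℕ}
    (hT : ∀ c ∈ T, ∃ a, IsGolden a ∧ a 0 = false ∧ wordCode a n = c ∧
      surprisal (fun _ => t) a n ≤ B) : (T.card : ℝ) ≤ Real.exp B := by
  set h : ℕ → unitInterval := fun _ => ⟨t, ht0.le, ht1.le⟩ with hh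
  set F : ℕ → Set (ℕ → Bool) := fun c => {b | wordCode (goldenDigit b) n = c} with hF
  have hmass : ∀ c ∈ T, ENNReal.ofReal (Real.exp (-B)) ≤ bitMeasure h (F c) := by
    intro c hc
    obtain ⟨a, ha, ha0, rfl, hs⟩ := hT c hc
    refine le_trans (ENNReal.ofReal_le_ofReal (Real.exp_le_exp.2 (neg_le_neg hs))) ?_
    rw [← bitMeasure_prefix h (fun _ => ht0) (fun _ => ht1) ha ha0 n]
    exact measure_mono fun b hb => wordCode_congr hb
  have hmeas : ∀ c, MeasurableSet (F c) := by
    intro c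
    have h1 : ∀ k, Measurable fun b => goldenDigit b k := by
      intro k
      refine measurable_to_bool ?_
      have h2 : (fun b => goldenDigit b k) ⁻¹' {true} =
          (fun b => digitVal (goldenDigit b) k) ⁻¹' {1} := by
        ext b
        simp [digitVal]
      rw [h2]
      exact measurable_digitVal k (measurableSet_singleton 1)
    have h3 : ∀ n, Measurable fun b => wordCode (goldenDigit b) n := by
      intro n
      induction n with
      | zero => exact measurable_const
      | succ n ih =>
        exact (ih.const_mul 2).add ((measurable_of_countable Bool.toNat).comp (h1 (n + 1)))
    exact h3 n (measurableSet_singleton c)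
  have hsum : ∑ c ∈ T, bitMeasure h (F c) ≤ 1 := by
    rw [← measure_biUnion_finset (fun c _ c' _ hcc => ?_) (fun c _ => hmeas c)]
    · exact prob_le_one
    · exact Set.disjoint_left.2 fun b hb hb' => hcc (hb.symm.trans hb')
  -- Each word in `T` has a disjoint cylinder of mass at least `exp (-B)`, and the total mass is at
  -- most one.
  have h1 : (T.card : ℝ≥0∞) * ENNReal.ofReal (Real.exp (-B)) ≤ 1 := by
    rw [← nsmul_eq_mul]
    exact (Finset.card_nsmul_le_sum _ _ _ hmass).trans hsum
  rw [← ENNReal.ofReal_natCast, ← ENNReal.ofReal_mul (by positivity),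
    ENNReal.ofReal_le_one, Real.exp_neg, ← div_eq_mul_inv, div_le_one (Real.exp_pos _)] at h1
  exact h1

/-- This is where `θ < 2` enters: `m^θ` loses to `m^2` by any constant. The extra `1` in `C + 1`
later yields `2^m / m^2`, enough for a summable factor. Using `max θ 0` keeps powers monotone in the
base for negative `θ`. -/
lemma eventually_rpow_log_le (C : ℝ) {θ : ℝ} (hθ : θ < 2) :
    ∀ᶠ m : ℕ in atTop, (C + 1) / (m : ℝ) ^ 2 ≤
      Real.log 2 / Real.log (2 ^ m * Real.log 2) ^ θ := by
  have hθ' : 0 < 2 - max θ 0 := by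
    rw [sub_pos]
    exact max_lt hθ two_pos
  have h1 : Tendsto (fun m : ℕ => (m : ℝ) ^ (2 - max θ 0)) atTop atTop :=
    (tendsto_rpow_atTop hθ').comp tendsto_natCast_atTop_atTop
  have hhalf : (1 : ℝ) / 2 ≤ Real.log 2 := by linarith [Real.log_two_gt_d9]
  have hlog2le : Real.log 2 ≤ 1 := by linarith [Real.log_two_lt_d9]
  filter_upwards [h1.eventually_ge_atTop (2 * (C + 1)), eventually_ge_atTop 3] with m hm hm3
  have hm3' : (3 : ℝ) ≤ m := by exact_mod_cast hm3
  have hm0 : (0 : ℝ) < m := by linarith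
  set x := Real.log (2 ^ m * Real.log 2) with hx
  have hxeq : x = m * Real.log 2 + Real.log (Real.log 2) := by
    rw [hx, Real.log_mul (by positivity) (by positivity), Real.log_pow]
  have hx1 : 1 ≤ x := by
    have h2 := Real.log_le_log (by norm_num) hhalf
    rw [one_div, Real.log_inv] at h2
    nlinarith
  have hxm : x ≤ m := by
    have h2 := Real.log_nonpos (by linarith) hlog2le
    nlinarith
  have hpow : x ^ θ ≤ (m : ℝ) ^ (max θ 0) :=
    (Real.rpow_le_rpow_of_exponent_le hx1 (le_max_left θ 0)).trans
      (Real.rpow_le_rpow (by linarith) hxm (le_max_right θ 0))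
  have hxpos : 0 < x ^ θ := Real.rpow_pos_of_pos (by linarith) θ
  rw [div_le_div_iff₀ (by positivity) hxpos]
  have hsplit : (m : ℝ) ^ 2 = (m : ℝ) ^ (2 - max θ 0) * (m : ℝ) ^ (max θ 0) := by
    rw [← Real.rpow_add hm0, sub_add_cancel]
    norm_num
  rw [hsplit]
  have hmpos : 0 < (m : ℝ) ^ (max θ 0) := Real.rpow_pos_of_pos hm0 _
  have hlpos : 0 < (m : ℝ) ^ (2 - max θ 0) := Real.rpow_pos_of_pos hm0 _
  calc (C + 1) * x ^ θ ≤ 1 / 2 * (m : ℝ) ^ (2 - max θ 0) * x ^ θ := by gcongr; linarith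
    _ ≤ 1 / 2 * (m : ℝ) ^ (2 - max θ 0) * (m : ℝ) ^ (max θ 0) := by gcongr
    _ = 1 / 2 * ((m : ℝ) ^ (2 - max θ 0) * (m : ℝ) ^ (max θ 0)) := by ring
    _ ≤ Real.log 2 * ((m : ℝ) ^ (2 - max θ 0) * (m : ℝ) ^ (max θ 0)) := by gcongr

lemma eventually_two_pow_ge : ∀ᶠ m : ℕ in atTop, (m : ℝ) + 1 ≤ 2 ^ m / (m : ℝ) ^ 2 := by
  have h1 : Tendsto (fun m : ℕ => (m : ℝ) ^ 3 / (2 : ℝ) ^ m) atTop (𝓝 0) :=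
    tendsto_pow_const_div_const_pow_of_one_lt 3 one_lt_two
  filter_upwards [h1.eventually (gt_mem_nhds (show (0 : ℝ) < 1 / 2 by norm_num)),
    eventually_ge_atTop 1] with m hm hm1
  have hm' : (1 : ℝ) ≤ m := by exact_mod_cast hm1
  rw [div_lt_iff₀ (by positivity)] at hm
  rw [le_div_iff₀ (by positivity)]
  nlinarith [sq_nonneg (m : ℝ)]

/-- The gauge beats the number of well predicted words at level `2 ^ m`. -/
lemma eventually_count_mul_psiGauge_le {L : ℝ} (C : ℝ) {θ : ℝ} (hθ : θ < 2) :
    ∀ᶠ m : ℕ in atTop, 2 * Real.exp (2 ^ m * (L + C / (m : ℝ) ^ 2)) *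
      psiGauge (L / Real.log 2) θ (1 / 2 ^ (2 ^ m)) ≤ (1 / 2) ^ m := by
  filter_upwards [eventually_rpow_log_le C hθ, eventually_two_pow_ge] with m h1 h2
  have hlog2 : 0 < Real.log 2 := Real.log_pos one_lt_two
  have hlog2le : Real.log 2 ≤ 1 := by linarith [Real.log_two_lt_d9]
  have hlogd : Real.log (1 / 2 ^ (2 ^ m)) = -(2 ^ m * Real.log 2) := by
    rw [one_div, Real.log_inv, Real.log_pow]
    push_cast
    ring
  have habs : |Real.log (1 / 2 ^ (2 ^ m))| = 2 ^ m * Real.log 2 := by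
    rw [hlogd, abs_neg, abs_of_nonneg (by positivity)]
  have hds : ((1 : ℝ) / 2 ^ (2 ^ m)) ^ (L / Real.log 2) = Real.exp (-(2 ^ m * L)) := by
    rw [Real.rpow_def_of_pos (by positivity), hlogd]
    congr 1
    field_simp
  rw [psiGauge, habs, hds, ← Real.exp_add]
  have h3 : ((1 : ℝ) / 2) ^ m = Real.exp (-(m * Real.log 2)) := by
    rw [← Real.log_pow, Real.exp_neg, Real.exp_log (by positivity), div_pow, one_pow, one_div]
  rw [h3]
  nth_rw 1 [← Real.exp_log (show (0 : ℝ) < 2 by norm_num)]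
  rw [← Real.exp_add, ← Real.exp_add, Real.exp_le_exp]
  have h4 := mul_le_mul_of_nonneg_left h1 (show (0 : ℝ) ≤ 2 ^ m by positivity)
  have h5 : (2 : ℝ) ^ m * ((C + 1) / (m : ℝ) ^ 2) =
      2 ^ m * (C / (m : ℝ) ^ 2) + 2 ^ m / (m : ℝ) ^ 2 := by ring
  have h6 : (2 : ℝ) ^ m * Real.log 2 / Real.log (2 ^ m * Real.log 2) ^ θ =
      2 ^ m * (Real.log 2 / Real.log (2 ^ m * Real.log 2) ^ θ) := by ring
  rw [h6]
  have h7 : ((m : ℝ) + 1) * Real.log 2 ≤ (m + 1) * 1 := by gcongr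
  linarith

/-- The dyadic interval with left end point `c / 2 ^ n`. -/
def dyadicIcc (n c : ℕ) : Set ℝ := Set.Icc ((c : ℝ) / 2 ^ n) ((c + 1 : ℝ) / 2 ^ n)

lemma ediam_dyadicIcc (n c : ℕ) : Metric.ediam (dyadicIcc n c) = ENNReal.ofReal (1 / 2 ^ n) := by
  rw [dyadicIcc, Real.ediam_Icc]
  congr 1
  ring

/-- A set that is covered infinitely often by dyadic intervals of summable total gauge is null. -/
lemma gaugeMeasure_eq_zero_of_covers {φ : ℝ → ℝ} {A : Set ℝ} {T : ℕ → Finset ℕ}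
    (hcover : ∀ x ∈ A, ∀ M : ℕ, ∃ m ≥ M, ∃ c ∈ T m, x ∈ dyadicIcc (2 ^ m) c)
    (hT : ∀ᶠ m : ℕ in atTop, (T m).card * ENNReal.ofReal (φ (1 / 2 ^ (2 ^ m))) ≤
      ENNReal.ofReal ((1 / 2) ^ m)) : gaugeMeasure φ A = 0 := by
  have hr : Tendsto (fun M : ℕ => ENNReal.ofReal ((1 / 2 : ℝ) ^ M)) atTop (𝓝 0) := by
    have := ENNReal.tendsto_ofReal (tendsto_pow_atTop_nhds_zero_of_lt_one
      (show (0 : ℝ) ≤ 1 / 2 by norm_num) (by norm_num))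
    rwa [ENNReal.ofReal_zero] at this
  have hle := Measure.mkMetric_le_liminf_tsum A (l := atTop)
    (ι := fun M : ℕ => Σ m : ℕ, T (M + m)) (fun M => ENNReal.ofReal ((1 / 2 : ℝ) ^ M)) hr
    (fun M i => dyadicIcc (2 ^ (M + i.1)) i.2)
    (Eventually.of_forall fun M i => by
      rw [ediam_dyadicIcc]
      apply ENNReal.ofReal_le_ofReal
      rw [div_pow, one_pow]
      gcongr
      · norm_num
      · exact (Nat.le_add_right M i.1).trans Nat.lt_two_pow_self.le)
    (Eventually.of_forall fun M x hx => by
      obtain ⟨m, hm, c, hc, hxc⟩ := hcover x hx M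
      obtain ⟨k, rfl⟩ := Nat.exists_eq_add_of_le hm
      exact Set.mem_iUnion.2 ⟨⟨k, ⟨c, hc⟩⟩, hxc⟩)
    (fun d => ENNReal.ofReal (φ d.toReal))
  have hlim : Tendsto (fun M : ℕ => ∑' i : (Σ m : ℕ, T (M + m)),
      ENNReal.ofReal (φ (Metric.ediam (dyadicIcc (2 ^ (M + i.1)) i.2)).toReal)) atTop (𝓝 0) := by
    have hr2 : Tendsto (fun M : ℕ => ENNReal.ofReal (2 * (1 / 2 : ℝ) ^ M)) atTop (𝓝 0) := by
      have := ENNReal.tendsto_ofReal ((tendsto_pow_atTop_nhds_zero_of_lt_one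
        (show (0 : ℝ) ≤ 1 / 2 by norm_num) (by norm_num)).const_mul 2)
      rwa [mul_zero, ENNReal.ofReal_zero] at this
    obtain ⟨N, hN⟩ := eventually_atTop.1 hT
    refine tendsto_of_tendsto_of_tendsto_of_le_of_le' tendsto_const_nhds hr2
      (Eventually.of_forall fun _ => zero_le) ?_
    filter_upwards [eventually_ge_atTop N] with M hM
    rw [ENNReal.tsum_sigma']
    have hterm : ∀ m : ℕ, ∑' c : T (M + m),
        ENNReal.ofReal (φ (Metric.ediam (dyadicIcc (2 ^ (M + m)) c)).toReal) ≤
        ENNReal.ofReal ((1 / 2 : ℝ) ^ M * (1 / 2) ^ m) := by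
      intro m
      simp_rw [ediam_dyadicIcc]
      rw [tsum_fintype, Finset.sum_const, Finset.card_univ, Fintype.card_coe, nsmul_eq_mul,
        ENNReal.toReal_ofReal (by positivity), ← pow_add]
      exact hN (M + m) (by omega)
    refine (ENNReal.tsum_le_tsum hterm).trans (le_of_eq ?_)
    have hs : HasSum (fun m : ℕ => (1 / 2 : ℝ) ^ M * (1 / 2) ^ m) ((1 / 2) ^ M * 2) :=
      hasSum_geometric_two.mul_left _
    rw [← ENNReal.ofReal_tsum_of_nonneg (fun m => by positivity) hs.summable, hs.tsum_eq, mul_comm]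
  rw [hlim.liminf_eq] at hle
  exact le_antisymm hle zero_le

lemma psiGauge_XiG_eq_zero {p : ℝ} (hp0 : 0 < p) (hp1 : p < 1) (hp : p ^ 3 = (1 - p) ^ 2) {θ : ℝ}
    (hθ : θ < 2) : gaugeMeasure (psiGauge (-Real.logb 2 p) θ) XiG = 0 := by
  classical
  obtain ⟨K, C, hK, hC, hfreq⟩ := exists_frequently_surprisal_le hp0 hp1 hp
  set P : ℝ → ℕ → ℕ → Prop := fun σ m c => ∃ a, IsGolden a ∧ a 0 = false ∧
    wordCode a (2 ^ m) = c ∧ surprisal (fun _ => 1 - p - σ * (K / m)) a (2 ^ m) ≤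
      2 ^ m * (-Real.log p + C / (m : ℝ) ^ 2) with hP
  have hcode : ∀ (a : ℕ → Bool) (n : ℕ), wordCode a n < 2 ^ n := by
    intro a n
    induction n with
    | zero => simp [wordCode]
    | succ n ih =>
      rw [wordCode, pow_succ]
      have := Bool.toNat_lt (a (n + 1))
      omega
  -- One family of words for each sign of the bias shift; each is counted with its own product
  -- measure, whence the factor `2`.
  set T : ℕ → Finset ℕ := fun m => (Finset.range (2 ^ (2 ^ m))).filter (P 1 m) ∪
    (Finset.range (2 ^ (2 ^ m))).filter (P (-1) m) with hTdef
  refine gaugeMeasure_eq_zero_of_covers (T := T) (fun x hx M => ?_) ?_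
  · obtain ⟨a, ha, ha0, rfl⟩ := mem_XiG_iff.1 hx
    obtain ⟨m, hm, σ, hσ, hs⟩ := hfreq a ha M
    refine ⟨m, hm, wordCode a (2 ^ m), ?_, binaryReal_mem a _⟩
    rw [hTdef, Finset.mem_union, Finset.mem_filter, Finset.mem_filter, Finset.mem_range]
    rcases eq_or_eq_neg_of_abs_eq hσ with rfl | rfl
    · exact Or.inl ⟨hcode a _, a, ha, ha0, rfl, hs⟩
    · exact Or.inr ⟨hcode a _, a, ha, ha0, rfl, hs⟩
  have hsmall : ∀ᶠ m : ℕ in atTop, K / (m : ℝ) < min p (1 - p) :=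
    (tendsto_const_nhds.div_atTop tendsto_natCast_atTop_atTop).eventually
      (gt_mem_nhds (lt_min hp0 (by linarith)))
  have hs : -Real.logb 2 p = -Real.log p / Real.log 2 := by rw [Real.logb, neg_div]
  filter_upwards [hsmall, eventually_count_mul_psiGauge_le (L := -Real.log p) C hθ] with m hm hm2
  rw [← hs] at hm2
  have hKm : 0 ≤ K / (m : ℝ) := by positivity
  have h1 := hm.trans_le (min_le_left _ _)
  have h2 := hm.trans_le (min_le_right _ _)
  have hcard : ((T m).card : ℝ) ≤ 2 * Real.exp (2 ^ m * (-Real.log p + C / (m : ℝ) ^ 2)) := by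
    have hpart : ∀ σ : ℝ, |σ| = 1 → (((Finset.range (2 ^ (2 ^ m))).filter (P σ m)).card : ℝ) ≤
        Real.exp (2 ^ m * (-Real.log p + C / (m : ℝ) ^ 2)) := by
      intro σ hσ
      have hb : |σ * (K / m)| < min p (1 - p) := by rwa [abs_mul, hσ, one_mul, abs_of_nonneg hKm]
      have hb' := abs_lt.1 hb
      have h3 := min_le_left p (1 - p)
      have h4 := min_le_right p (1 - p)
      exact card_le_exp_of_surprisal_le (t := 1 - p - σ * (K / m)) (by linarith) (by linarith)
        fun c hc => (Finset.mem_filter.1 hc).2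
    have hu : ((T m).card : ℝ) ≤ ((Finset.range (2 ^ (2 ^ m))).filter (P 1 m)).card +
        ((Finset.range (2 ^ (2 ^ m))).filter (P (-1) m)).card := by
      rw [← Nat.cast_add]
      exact Nat.cast_le.2 (Finset.card_union_le _ _)
    linarith [hpart 1 (by norm_num), hpart (-1) (by norm_num)]
  rw [← ENNReal.ofReal_natCast, ← ENNReal.ofReal_mul (by positivity)]
  refine ENNReal.ofReal_le_ofReal (le_trans ?_ hm2)
  refine mul_le_mul_of_nonneg_right hcard ?_
  unfold psiGauge
  positivity

/-! ### Assembly -/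

theorem theorem2 (p : ℝ) (hp0 : 0 < p) (hp1 : p < 1) (hp : p ^ 3 = (1 - p) ^ 2)
    (s : ℝ) (hs : s = (dimH XiG).toReal) :
    (dimH XiG = ENNReal.ofReal s ∧ s = -Real.logb 2 p) ∧
    (Measure.hausdorffMeasure s XiG = ⊤ ∧
      ¬ SigmaFinite ((Measure.hausdorffMeasure s : Measure ℝ).restrict XiG)) ∧
    (∃ c₀ : ℝ, 0 < c₀ ∧ ∀ c : ℝ, 0 < c → c < c₀ →
      gaugeMeasure (phiGauge s c) XiG = ⊤ ∧
      ¬ SigmaFinite ((gaugeMeasure (phiGauge s c)).restrict XiG)) ∧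
    (∀ θ : ℝ, θ < 2 → gaugeMeasure (psiGauge s θ) XiG = 0) := by
  obtain ⟨c₀, hc₀, hne⟩ := exists_phiGauge_ne_zero hp0 hp1 hp
  have hpos : 0 < -Real.logb 2 p := neg_pos.2 (Real.logb_neg one_lt_two hp0 hp1)
  have hzero : ∀ θ : ℝ, θ < 2 → gaugeMeasure (psiGauge (-Real.logb 2 p) θ) XiG = 0 :=
    fun θ hθ => psiGauge_XiG_eq_zero hp0 hp1 hp hθ
  have hdim : dimH XiG = ENNReal.ofReal (-Real.logb 2 p) := by
    refine dimH_XiG_eq hpos ?_ (hzero 1 one_lt_two)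
    rw [hausdorffMeasure_eq_gaugeMeasure hpos]
    exact hne 0 le_rfl hc₀
  have hseq : s = -Real.logb 2 p := by rw [hs, hdim, ENNReal.toReal_ofReal hpos.le]
  have hσ : ∀ c : ℝ, 0 ≤ c → c < c₀ →
      ¬ SigmaFinite ((gaugeMeasure (phiGauge (-Real.logb 2 p) c)).restrict XiG) := by
    intro c hc0 hc
    -- Nonzero measure at a slightly larger constant excludes σ-finiteness at `c`, which in turn
    -- makes the measure infinite.
    obtain ⟨c', h1, h2⟩ := exists_between hc
    exact not_sigmaFinite_phiGauge hpos h1 (hne c' (by linarith) h2)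
  rw [hseq, hausdorffMeasure_eq_gaugeMeasure hpos]
  exact ⟨⟨hdim, rfl⟩, ⟨measure_eq_top_of_not_sigmaFinite (hσ 0 le_rfl hc₀), hσ 0 le_rfl hc₀⟩,
    ⟨c₀, hc₀, fun c hc0 hc =>
      ⟨measure_eq_top_of_not_sigmaFinite (hσ c hc0.le hc), hσ c hc0.le hc⟩⟩, hzero⟩
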